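/- Let $\mathbf{t} = t_0t_1t_2\cdots = 01101001\cdots$ be the Thue--Morse word, where $t_m \in \{0,1\}$ is the parity of the number of ones in the binary expansion of $m$. For $n \geq 0$ let $c(n)$ be the number of length-$n$ factors (blocks $t_i t_{i+1}\cdots t_{i+n-1}$, $i \geq 0$) of $\mathbf{t}$, where factors that are cyclic rotations of one another are counted only once. Then, for every integer $n \geq 0$, $$c(n) = \tfrac{4}{3}n - 4 \quad\text{if and only if}\quad n \in J,$$ where $J = \{ (2^{2i+1}+1)\,2^j : i \geq 1,\ j \geq 0 \}$. -/

import Mathlib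

/-- The Thue-Morse word `0110100110010110...` over the alphabet `{0, 1}`, with positions counted
from `0`: its letter at position `n` is the parity of the number of ones in the binary
expansion of `n`. -/
def thueMorse (n : ℕ) : ZMod 2 := ((Nat.digits 2 n).sum : ZMod 2)

/-- The factor `x[i] x[i+1] ... x[i+n-1]` of length `n` of the infinite word `x`. -/
def factorAt {α : Type*} (x : ℕ → α) (i n : ℕ) : List α :=
  (List.range n).map (fun k => x (i + k))

/-- The set of all factors of length `n` of the infinite word `x`. -/
def factors {α : Type*} (x : ℕ → α) (n : ℕ) : Set (List α) :=
  {w | ∃ i : ℕ, w = factorAt x i n}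

/-- The cyclic complexity `c_x(n)` of the infinite word `x` over a finite alphabet: the number of
factors of length `n` of `x`, where factors that are cyclic rotations of one another are counted
once. (`Cycle α` is the type of lists over `α` up to rotation.) -/
noncomputable def cyclicComplexity {α : Type*} (x : ℕ → α) (n : ℕ) : ℕ :=
  ((fun w : List α => (w : Cycle α)) '' factors x n).ncard

/-- The set counted by `cyclicComplexity` is finite when the alphabet is finite. -/
theorem finite_cyclic_factors {α : Type*} [Finite α] (x : ℕ → α) (n : ℕ) :
    ((fun w : List α => (w : Cycle α)) '' factors x n).Finite := by
  refine Set.Finite.image _ ((List.finite_length_eq α n).subset ?_)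
  rintro w ⟨i, rfl⟩
  simp [factorAt]

/-- The set `J` of all numbers `(2^(2i+1) + 1) 2^j` with `i ≥ 1` and `j ≥ 0`. -/
def setJ : Set ℕ :=
  {n | ∃ i j : ℕ, 1 ≤ i ∧ n = (2 ^ (2 * i + 1) + 1) * 2 ^ j}

/-! Let μ be the morphism 0 ↦ 01, 1 ↦ 10, let E_δ(m) be `endsCount m δ`, and put D = 3E_1 − 4m, S =
3E_0 − 4m. Parity of position is recognizable from four letters, so factors desubstitute through μ.
This gives linear recurrences for E_δ, hence for D and S, and an induction proves D ≥ 0.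

Desubstituting cyclic words as well, for m ≥ 4, gives c(2m) = c(m) + E_1(m) and c(2m+1) = 2(E_0(m) +
E_1(m)) − E_1(m) − E_1(m+1) − F(m). Here F(m) counts the exceptional pairs `forbiddenExtensions 1
m`, which can occur only for m = 3·2^k with k odd.

Let e(n) = 3c(n) + 12 − 4n. Then e(2m) = e(m) + D(m) and e(2m+1) = D(2m+1) + 12 − 3s(m) − 3F(m),
where s(m) ∈ {2, 4} is the increment of the ordinary factor count. Thus e ≥ 0: where F can be
nonzero it is at most 4, and D(2m+1) ≥ 12 with s(m) = 2 outweighs it. For odd n = 2m+1, e = 0 means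
D(2m+1) = 0 and s(m) = 4, which happens exactly for m = 4^j, j ≥ 1. For even n, e(2m) = 0 iff e(m) =
0, because D vanishes on J. -/

theorem zmod_two_eq_add_one_of_ne {a b : ZMod 2} (h : a ≠ b) : a = b + 1 := by
  decide +revert

theorem zmod_two_add_one_ne (a : ZMod 2) : a + 1 ≠ a := by
  decide +revert

theorem zmod_two_add_one_add_one (a : ZMod 2) : a + 1 + 1 = a := by
  decide +revert

theorem zmod_two_add_eq_one_iff {a b : ZMod 2} : a + b = 1 ↔ a = b + 1 := by
  decide +revert

/-! ### Letters of the word and synchronization of parity. -/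

theorem thueMorse_two_mul (n : ℕ) : thueMorse (2 * n) = thueMorse n := by
  rcases Nat.eq_zero_or_pos n with rfl | h
  · rfl
  · unfold thueMorse
    rw [Nat.digits_def' (by norm_num) (by omega)]
    simp

theorem thueMorse_two_mul_add_one (n : ℕ) : thueMorse (2 * n + 1) = thueMorse n + 1 := by
  unfold thueMorse
  rw [Nat.digits_def' (by norm_num) (by omega), show (2 * n + 1) / 2 = n by omega,
    show (2 * n + 1) % 2 = 1 by omega]
  simp [add_comm]

theorem thueMorse_not_cube (i : ℕ) :
    ¬ (thueMorse i = thueMorse (i + 1) ∧ thueMorse (i + 1) = thueMorse (i + 2)) := by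
  rintro ⟨h₁, h₂⟩
  obtain ⟨k, rfl | rfl⟩ := Nat.even_or_odd' i
  · rw [thueMorse_two_mul, thueMorse_two_mul_add_one] at h₁
    exact zmod_two_add_one_ne _ h₁.symm
  · rw [show 2 * k + 1 + 1 = 2 * (k + 1) by ring, show 2 * k + 1 + 2 = 2 * (k + 1) + 1 by ring,
      thueMorse_two_mul, thueMorse_two_mul_add_one] at h₂
    exact zmod_two_add_one_ne _ h₂.symm

/-- An even and an odd position of the Thue-Morse word never start the same block of length `4`. -/
theorem thueMorse_synchronize {i j : ℕ}
    (h : ∀ k < 4, thueMorse (2 * i + k) = thueMorse (2 * j + 1 + k)) : False := by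
  have h0 := h 0 (by norm_num)
  have h1 := h 1 (by norm_num)
  have h2 := h 2 (by norm_num)
  have h3 := h 3 (by norm_num)
  have hc := thueMorse_not_cube j
  rw [show 2 * j + 1 + 0 = 2 * j + 1 by ring, show 2 * i + 0 = 2 * i by ring,
    thueMorse_two_mul, thueMorse_two_mul_add_one] at h0
  rw [show 2 * j + 1 + 1 = 2 * (j + 1) by ring,
    thueMorse_two_mul, thueMorse_two_mul_add_one] at h1
  rw [show 2 * j + 1 + 2 = 2 * (j + 1) + 1 by ring, show 2 * i + 2 = 2 * (i + 1) by ring,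
    thueMorse_two_mul, thueMorse_two_mul_add_one] at h2
  rw [show 2 * j + 1 + 3 = 2 * (j + 2) by ring, show 2 * i + 3 = 2 * (i + 1) + 1 by ring,
    thueMorse_two_mul, thueMorse_two_mul_add_one] at h3
  -- Each equation compares halves of differently aligned blocks; together they force t_j = t_{j+1}
  -- = t_{j+2}, a cube.
  apply hc
  generalize thueMorse i = a, thueMorse (i + 1) = b, thueMorse j = c,
    thueMorse (j + 1) = d, thueMorse (j + 2) = e at h0 h1 h2 h3
  clear h hc
  decide +revert

/-! ### Factors of an arbitrary infinite word. -/

section FactorAt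

variable {α : Type*} (x : ℕ → α)

theorem length_factorAt (i n : ℕ) : (factorAt x i n).length = n := by
  simp [factorAt]

theorem factorAt_zero (i : ℕ) : factorAt x i 0 = [] := rfl

theorem factorAt_eq_iff {x : ℕ → α} {i j n : ℕ} :
    factorAt x i n = factorAt x j n ↔ ∀ k < n, x (i + k) = x (j + k) := by
  simp [factorAt]

theorem factorAt_succ (i n : ℕ) : factorAt x i (n + 1) = x i :: factorAt x (i + 1) n := by
  simp [factorAt, List.range_succ_eq_map, Function.comp_def, add_assoc, add_comm 1]

theorem factorAt_succ_right (i n : ℕ) :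
    factorAt x i (n + 1) = factorAt x i n ++ [x (i + n)] := by
  simp [factorAt, List.range_succ]

theorem factorAt_add (i m n : ℕ) :
    factorAt x i (m + n) = factorAt x i m ++ factorAt x (i + m) n := by
  induction n with
  | zero => simp [factorAt_zero]
  | succ n ih => rw [← add_assoc, factorAt_succ_right, ih, factorAt_succ_right, add_assoc,
      List.append_assoc]

theorem factorAt_mem_factors (i n : ℕ) : factorAt x i n ∈ factors x n := ⟨i, rfl⟩

theorem length_of_mem_factors {x : ℕ → α} {n : ℕ} {w : List α} (h : w ∈ factors x n) :
    w.length = n := by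
  obtain ⟨i, rfl⟩ := h
  exact length_factorAt x i n

theorem finite_factors [Finite α] (n : ℕ) : (factors x n).Finite :=
  (List.finite_length_eq α n).subset fun _ h => length_of_mem_factors h

theorem cons_mem_factors_iff {x : ℕ → α} {n : ℕ} {a : α} {w : List α} :
    a :: w ∈ factors x (n + 1) ↔ ∃ i, x i = a ∧ w = factorAt x (i + 1) n := by
  simp only [factors, Set.mem_ofPred_eq, factorAt_succ, List.cons.injEq]
  exact ⟨fun ⟨i, h₁, h₂⟩ => ⟨i, h₁.symm, h₂⟩, fun ⟨i, h₁, h₂⟩ => ⟨i, h₁.symm, h₂⟩⟩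

theorem append_mem_factors_iff {x : ℕ → α} {n : ℕ} {a : α} {w : List α} :
    w ++ [a] ∈ factors x (n + 1) ↔ ∃ i, w = factorAt x i n ∧ x (i + n) = a := by
  simp only [factors, Set.mem_ofPred_eq, factorAt_succ_right]
  constructor
  · rintro ⟨i, h⟩
    obtain ⟨h₁, h₂⟩ := List.append_inj' h rfl
    exact ⟨i, h₁, by simpa using h₂.symm⟩
  · rintro ⟨i, h₁, h₂⟩
    exact ⟨i, by rw [h₁, h₂]⟩

theorem infix_mem_factors {x : ℕ → α} {n : ℕ} {u v w : List α}
    (h : u ++ v ++ w ∈ factors x n) : v ∈ factors x v.length := by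
  obtain ⟨i, h⟩ := h
  have hn : n = u.length + v.length + w.length := by
    have := congrArg List.length h
    simp [length_factorAt] at this
    omega
  subst hn
  rw [factorAt_add, factorAt_add] at h
  obtain ⟨h, -⟩ := List.append_inj h (by simp [length_factorAt])
  obtain ⟨-, h⟩ := List.append_inj h (by simp [length_factorAt])
  exact ⟨_, h⟩

end FactorAt

/-! ### Cube-freeness and the morphism μ. -/

theorem replicate_three_notMem_factors {n : ℕ} {u v : List (ZMod 2)} {a : ZMod 2} :
    u ++ List.replicate 3 a ++ v ∉ factors thueMorse n := by
  intro h
  obtain ⟨i, h⟩ := infix_mem_factors h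
  simp [factorAt, List.range_succ, List.replicate] at h
  exact thueMorse_not_cube i ⟨by rw [← h.1, ← h.2.1], by rw [← h.2.1, ← h.2.2]⟩

theorem le_two_of_replicate_mem_factors {n k : ℕ} {u v : List (ZMod 2)} {a : ZMod 2}
    (h : u ++ List.replicate k a ++ v ∈ factors thueMorse n) : k ≤ 2 := by
  by_contra hk
  obtain ⟨l, rfl⟩ := Nat.exists_eq_add_of_lt (not_le.mp hk)
  rw [show 2 + l + 1 = l + 3 by ring, List.replicate_add, ← List.append_assoc] at h
  exact replicate_three_notMem_factors h

/-- The Thue-Morse morphism `0 ↦ 01`, `1 ↦ 10`. -/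
def thueMorseMap : List (ZMod 2) → List (ZMod 2)
  | [] => []
  | a :: l => a :: (a + 1) :: thueMorseMap l

theorem thueMorseMap_append (l₁ l₂ : List (ZMod 2)) :
    thueMorseMap (l₁ ++ l₂) = thueMorseMap l₁ ++ thueMorseMap l₂ := by
  induction l₁ with
  | nil => rfl
  | cons a l ih => simp [thueMorseMap, ih]

theorem thueMorseMap_singleton (a : ZMod 2) : thueMorseMap [a] = [a, a + 1] := rfl

theorem length_thueMorseMap (l : List (ZMod 2)) : (thueMorseMap l).length = 2 * l.length := by
  induction l with
  | nil => rfl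
  | cons a l ih => simp [thueMorseMap, ih]; ring

theorem thueMorseMap_injective : Function.Injective thueMorseMap := by
  intro l
  induction l with
  | nil =>
    rintro (_ | _) h
    · rfl
    · cases h
  | cons a l ih =>
    rintro (_ | ⟨b, l'⟩) h
    · cases h
    · simp only [thueMorseMap, List.cons.injEq] at h
      rw [h.1, ih h.2.2]

theorem thueMorseMap_factorAt (i n : ℕ) :
    thueMorseMap (factorAt thueMorse i n) = factorAt thueMorse (2 * i) (2 * n) := by
  induction n with
  | zero => rfl
  | succ n ih =>
    rw [factorAt_succ_right, thueMorseMap_append, ih, thueMorseMap_singleton,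
      show 2 * (n + 1) = 2 * n + 1 + 1 by ring, factorAt_succ_right, factorAt_succ_right,
      show 2 * i + (2 * n + 1) = 2 * (i + n) + 1 by ring,
      show 2 * i + 2 * n = 2 * (i + n) by ring, thueMorse_two_mul, thueMorse_two_mul_add_one]
    simp

theorem thueMorseMap_split {y l₁ l₂ : List (ZMod 2)} (h : thueMorseMap y = l₁ ++ l₂)
    (he : Even l₁.length) :
    ∃ y₁ y₂, y = y₁ ++ y₂ ∧ l₁ = thueMorseMap y₁ ∧ l₂ = thueMorseMap y₂ := by
  obtain ⟨k, hk⟩ := he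
  have hl := congrArg List.length h
  rw [length_thueMorseMap, List.length_append] at hl
  have h' := h
  rw [← List.take_append_drop k y, thueMorseMap_append] at h'
  obtain ⟨h₁, h₂⟩ := List.append_inj h' (by rw [length_thueMorseMap, List.length_take]; omega)
  exact ⟨_, _, (List.take_append_drop k y).symm, h₁.symm, h₂.symm⟩

/-- The two block decompositions are offset by one letter, so every letter is the complement of its
predecessor and the word alternates. This is the source of all later contradictions with
cube-freeness. -/
theorem cons_thueMorseMap_eq {a b : ZMod 2} {v w : List (ZMod 2)}
    (h : a :: thueMorseMap v = thueMorseMap w ++ [b]) :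
    v = List.replicate v.length (a + 1) ∧ b = a ∧ w = List.replicate v.length a := by
  induction v generalizing a w with
  | nil =>
    rcases w with _ | ⟨c, w⟩
    · simp [thueMorseMap] at h
      simp [h]
    · simp [thueMorseMap] at h
  | cons d v ih =>
    rcases w with _ | ⟨c, w⟩
    · simp [thueMorseMap] at h
    · simp only [thueMorseMap, List.cons_append, List.cons.injEq] at h
      obtain ⟨rfl, rfl, h⟩ := h
      rw [zmod_two_add_one_add_one] at h
      obtain ⟨h₁, h₂, h₃⟩ := ih h
      refine ⟨?_, h₂, ?_⟩
      · rw [List.length_cons, List.replicate_succ, ← h₁]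
      · rw [List.length_cons, List.replicate_succ, ← h₃]

theorem cons_thueMorseMap_append_eq {a b : ZMod 2} {v w : List (ZMod 2)}
    (h : a :: (thueMorseMap v ++ [b]) = thueMorseMap w) :
    v = List.replicate v.length (a + 1) ∧ b = a + 1 := by
  rcases List.eq_nil_or_concat' w with rfl | ⟨w, c, rfl⟩
  · cases h
  · rw [thueMorseMap_append, thueMorseMap_singleton, ← List.cons_append,
      show thueMorseMap w ++ [c, c + 1] = thueMorseMap w ++ [c] ++ [c + 1] by simp] at h
    obtain ⟨h₁, h₂⟩ := List.append_inj' h rfl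
    obtain ⟨h₃, h₄, -⟩ := cons_thueMorseMap_eq h₁
    refine ⟨h₃, ?_⟩
    rw [← h₄]
    simpa using h₂

/-! ### Desubstitution of factors, and counts by end letters. -/

theorem factorAt_thueMorse_even_odd (i n : ℕ) : factorAt thueMorse (2 * i) (2 * n + 1) =
    thueMorseMap (factorAt thueMorse i n) ++ [thueMorse (i + n)] := by
  rw [factorAt_succ_right, thueMorseMap_factorAt, ← mul_add, thueMorse_two_mul]

theorem factorAt_thueMorse_odd_odd (i n : ℕ) : factorAt thueMorse (2 * i + 1) (2 * n + 1) =
    (thueMorse i + 1) :: thueMorseMap (factorAt thueMorse (i + 1) n) := by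
  rw [factorAt_succ, thueMorseMap_factorAt, thueMorse_two_mul_add_one,
    show 2 * i + 1 + 1 = 2 * (i + 1) by ring]

theorem factorAt_thueMorse_odd_even (i n : ℕ) : factorAt thueMorse (2 * i + 1) (2 * n + 2) =
    (thueMorse i + 1) :: (thueMorseMap (factorAt thueMorse (i + 1) n) ++
      [thueMorse (i + 1 + n)]) := by
  rw [factorAt_succ, thueMorse_two_mul_add_one, show 2 * i + 1 + 1 = 2 * (i + 1) by ring,
    factorAt_thueMorse_even_odd]

theorem append_singleton_inj {α : Type*} {l l' : List α} {a a' : α} :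
    l ++ [a] = l' ++ [a'] ↔ l = l' ∧ a = a' := by
  constructor
  · intro h
    obtain ⟨h₁, h₂⟩ := List.append_inj' h rfl
    exact ⟨h₁, by simpa using h₂⟩
  · rintro ⟨rfl, rfl⟩
    rfl

theorem factorAt_even_even_eq_iff {i j n : ℕ} :
    factorAt thueMorse (2 * i) (2 * n) = factorAt thueMorse (2 * j) (2 * n) ↔
      factorAt thueMorse i n = factorAt thueMorse j n := by
  rw [← thueMorseMap_factorAt, ← thueMorseMap_factorAt, thueMorseMap_injective.eq_iff]

theorem factorAt_even_odd_eq_iff {i j n : ℕ} :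
    factorAt thueMorse (2 * i) (2 * n + 1) = factorAt thueMorse (2 * j) (2 * n + 1) ↔
      factorAt thueMorse i (n + 1) = factorAt thueMorse j (n + 1) := by
  rw [factorAt_thueMorse_even_odd, factorAt_thueMorse_even_odd, append_singleton_inj,
    thueMorseMap_injective.eq_iff, factorAt_succ_right, factorAt_succ_right, append_singleton_inj]

theorem factorAt_odd_odd_eq_iff {i j n : ℕ} :
    factorAt thueMorse (2 * i + 1) (2 * n + 1) = factorAt thueMorse (2 * j + 1) (2 * n + 1) ↔
      factorAt thueMorse i (n + 1) = factorAt thueMorse j (n + 1) := by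
  rw [factorAt_thueMorse_odd_odd, factorAt_thueMorse_odd_odd, List.cons.injEq,
    thueMorseMap_injective.eq_iff, factorAt_succ, factorAt_succ, List.cons.injEq, add_left_inj]

theorem factorAt_odd_even_eq_iff {i j n : ℕ} :
    factorAt thueMorse (2 * i + 1) (2 * n + 2) = factorAt thueMorse (2 * j + 1) (2 * n + 2) ↔
      factorAt thueMorse i (n + 2) = factorAt thueMorse j (n + 2) := by
  rw [factorAt_thueMorse_odd_even, factorAt_thueMorse_odd_even, List.cons.injEq,
    append_singleton_inj, thueMorseMap_injective.eq_iff, show n + 2 = n + 1 + 1 from rfl,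
    factorAt_succ _ _ (n + 1), factorAt_succ _ _ (n + 1), List.cons.injEq, factorAt_succ_right,
    factorAt_succ_right, append_singleton_inj, add_left_inj]

theorem factorAt_even_ne_odd {i j n : ℕ} (hn : 4 ≤ n) :
    factorAt thueMorse (2 * i) n ≠ factorAt thueMorse (2 * j + 1) n := fun h =>
  thueMorse_synchronize fun k hk => factorAt_eq_iff.mp h k (by omega)

/-- Two maps with the same fibres on `t` have equinumerous images. The reindexing `φ` is there for
positions 2i and 2i + 1. -/
theorem ncard_image_congr {α β γ δ : Type*} [Nonempty β] {f : α → γ} {g : β → δ} {φ : β → α}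
    {t : Set β} (h : ∀ x ∈ t, ∀ y ∈ t, f (φ x) = f (φ y) ↔ g x = g y) :
    (f '' (φ '' t)).ncard = (g '' t).ncard := by
  set k : δ → γ := fun d => f (φ (Function.invFunOn g t d))
  have hk : ∀ x ∈ t, k (g x) = f (φ x) := fun x hx =>
    (h _ (Function.invFunOn_apply_mem hx) _ hx).mpr (Function.invFunOn_apply_eq hx)
  have : f '' (φ '' t) = k '' (g '' t) := by
    rw [Set.image_image, Set.image_image]
    exact Set.image_congr fun x hx => (hk x hx).symm
  rw [this, Set.InjOn.ncard_image]
  rintro _ ⟨x, hx, rfl⟩ _ ⟨y, hy, rfl⟩ hxy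
  rw [hk x hx, hk y hy] at hxy
  exact (h x hx y hy).mp hxy

/-- The number of factors of length `m + 1` of the Thue-Morse word whose first and last letters
add up to `δ`. -/
noncomputable def endsCount (m : ℕ) (δ : ZMod 2) : ℕ :=
  ((fun i => factorAt thueMorse i (m + 1)) '' {i | thueMorse i + thueMorse (i + m) = δ}).ncard

theorem finite_image_factorAt (n : ℕ) (s : Set ℕ) :
    ((fun i => factorAt thueMorse i n) '' s).Finite :=
  (finite_factors thueMorse n).subset (by rintro _ ⟨i, -, rfl⟩; exact ⟨i, rfl⟩)

theorem ncard_image_factorAt_split {n : ℕ} (hn : 4 ≤ n) (s : Set ℕ) :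
    ((fun i => factorAt thueMorse i n) '' s).ncard =
      ((fun i => factorAt thueMorse i n) '' ((2 * ·) '' {i | 2 * i ∈ s})).ncard +
      ((fun i => factorAt thueMorse i n) '' ((2 * · + 1) '' {i | 2 * i + 1 ∈ s})).ncard := by
  rw [← Set.ncard_union_eq _ (finite_image_factorAt _ _) (finite_image_factorAt _ _),
    ← Set.image_union]
  · congr 2
    ext i
    simp only [Set.mem_union, Set.mem_image, Set.mem_ofPred_eq]
    constructor
    · intro hi
      obtain ⟨k, rfl | rfl⟩ := Nat.even_or_odd' i
      exacts [Or.inl ⟨k, hi, rfl⟩, Or.inr ⟨k, hi, rfl⟩]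
    · rintro (⟨k, hk, rfl⟩ | ⟨k, hk, rfl⟩) <;> exact hk
  · rw [Set.disjoint_left]
    rintro _ ⟨_, ⟨i, -, rfl⟩, rfl⟩ ⟨_, ⟨j, -, rfl⟩, h⟩
    exact factorAt_even_ne_odd hn h.symm

/-- At either parity of the start, a factor of length 2m + 1 corresponds to one of length m + 1. Its
two end letters are both kept or both complemented, so their sum is unchanged. -/
theorem endsCount_two_mul {m : ℕ} (hm : 2 ≤ m) (δ : ZMod 2) :
    endsCount (2 * m) δ = 2 * endsCount m δ := by
  rw [endsCount, ncard_image_factorAt_split (by omega),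
    ncard_image_congr (g := fun i => factorAt thueMorse i (m + 1)) fun _ _ _ _ =>
      factorAt_even_odd_eq_iff,
    ncard_image_congr (g := fun i => factorAt thueMorse i (m + 1)) fun _ _ _ _ =>
      factorAt_odd_odd_eq_iff, two_mul (endsCount m δ), endsCount]
  congr 3
  · ext i
    simp only [Set.mem_ofPred_eq]
    rw [← mul_add, thueMorse_two_mul, thueMorse_two_mul]
  · ext i
    simp only [Set.mem_ofPred_eq]
    rw [show 2 * i + 1 + 2 * m = 2 * (i + m) + 1 by ring, thueMorse_two_mul_add_one,
      thueMorse_two_mul_add_one]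
    generalize thueMorse i = a, thueMorse (i + m) = b
    decide +revert

/-- An even start gives a preimage of length m + 1, an odd start one of length m + 2. In both cases
exactly one end letter is complemented, which flips δ. -/
theorem endsCount_two_mul_add_one {m : ℕ} (hm : 1 ≤ m) (δ : ZMod 2) :
    endsCount (2 * m + 1) δ = endsCount m (δ + 1) + endsCount (m + 1) (δ + 1) := by
  rw [endsCount, show 2 * m + 1 + 1 = 2 * (m + 1) by ring,
    ncard_image_factorAt_split (by omega),
    ncard_image_congr (g := fun i => factorAt thueMorse i (m + 1)) fun _ _ _ _ =>
      factorAt_even_even_eq_iff,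
    ncard_image_congr (g := fun i => factorAt thueMorse i (m + 1 + 1)) fun _ _ _ _ =>
      factorAt_odd_even_eq_iff, endsCount, endsCount]
  congr 3
  · ext i
    simp only [Set.mem_ofPred_eq]
    rw [show 2 * i + (2 * m + 1) = 2 * (i + m) + 1 by ring, thueMorse_two_mul,
      thueMorse_two_mul_add_one]
    generalize thueMorse i = a, thueMorse (i + m) = b
    decide +revert
  · ext i
    simp only [Set.mem_ofPred_eq]
    rw [show 2 * i + 1 + (2 * m + 1) = 2 * (i + (m + 1)) by ring, thueMorse_two_mul_add_one,
      thueMorse_two_mul]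
    generalize thueMorse i = a, thueMorse (i + (m + 1)) = b
    decide +revert

theorem ncard_factors (m : ℕ) :
    (factors thueMorse (m + 1)).ncard = endsCount m 0 + endsCount m 1 := by
  rw [endsCount, endsCount, ← Set.ncard_union_eq _ (finite_image_factorAt _ _)
    (finite_image_factorAt _ _), ← Set.image_union]
  · congr 1
    ext w
    simp only [factors, Set.mem_image, Set.mem_union, Set.mem_ofPred_eq]
    refine exists_congr fun i => ?_
    have : ∀ z : ZMod 2, z = 0 ∨ z = 1 := by decide
    simp [this, eq_comm]
  · rw [Set.disjoint_left]
    rintro _ ⟨i, hi, rfl⟩ ⟨j, hj, h⟩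
    simp only [Set.mem_ofPred_eq] at hi hj
    have h' := factorAt_eq_iff.mp h
    have h0 := h' 0 (by omega)
    have hm := h' m (by omega)
    rw [add_zero, add_zero] at h0
    rw [h0, hm, hi] at hj
    exact zero_ne_one hj

/-! ### Initial values of the end-letter counts. -/

theorem thueMorse_values : thueMorse 0 = 0 ∧ thueMorse 1 = 1 ∧ thueMorse 2 = 1 ∧
    thueMorse 3 = 0 ∧ thueMorse 4 = 1 ∧ thueMorse 5 = 0 ∧ thueMorse 6 = 0 ∧ thueMorse 7 = 1 ∧
    thueMorse 8 = 1 ∧ thueMorse 9 = 0 ∧ thueMorse 10 = 0 ∧ thueMorse 11 = 1 ∧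
    thueMorse 12 = 0 := by
  simp [thueMorse]
  decide

theorem ncard_image_factorAt_eq_card {n : ℕ} {s : Set ℕ} {S : Finset (List (ZMod 2))}
    (h₁ : ∀ i ∈ s, factorAt thueMorse i n ∈ S)
    (h₂ : ∀ w ∈ S, ∃ i ∈ s, factorAt thueMorse i n = w) :
    ((fun i => factorAt thueMorse i n) '' s).ncard = S.card := by
  rw [← Set.ncard_coe_finset]
  congr 1
  ext w
  constructor
  · rintro ⟨i, hi, rfl⟩
    exact h₁ i hi
  · intro hw
    exact h₂ w hw

theorem endsCount_one_zero : endsCount 1 0 = 2 := by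
  obtain ⟨h0, h1, h2, h3, h4, h5, h6, h7, h8, h9, h10, h11, h12⟩ := thueMorse_values
  refine ncard_image_factorAt_eq_card (S := {[0, 0], [1, 1]}) (fun i hi => ?_) ?_
  · simp only [Set.mem_ofPred_eq] at hi
    simp only [factorAt, List.range_succ, List.range_zero, List.nil_append, List.cons_append,
      List.map_cons, List.map_nil, add_zero]
    generalize thueMorse i = a, thueMorse (i + 1) = b at *
    decide +revert
  · simp only [Finset.mem_insert, Finset.mem_singleton, forall_eq_or_imp, forall_eq]
    exact ⟨⟨5, by simp [h5, h6], by simp [factorAt, List.range_succ, h5, h6]⟩,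
      ⟨1, by simp [h1, h2]; decide, by simp [factorAt, List.range_succ, h1, h2]⟩⟩

theorem endsCount_one_one : endsCount 1 1 = 2 := by
  obtain ⟨h0, h1, h2, h3, h4, h5, h6, h7, h8, h9, h10, h11, h12⟩ := thueMorse_values
  refine ncard_image_factorAt_eq_card (S := {[0, 1], [1, 0]}) (fun i hi => ?_) ?_
  · simp only [Set.mem_ofPred_eq] at hi
    simp only [factorAt, List.range_succ, List.range_zero, List.nil_append, List.cons_append,
      List.map_cons, List.map_nil, add_zero]
    generalize thueMorse i = a, thueMorse (i + 1) = b at *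
    decide +revert
  · simp only [Finset.mem_insert, Finset.mem_singleton, forall_eq_or_imp, forall_eq]
    exact ⟨⟨0, by simp [h0, h1], by simp [factorAt, List.range_succ, h0, h1]⟩,
      ⟨2, by simp [h2, h3], by simp [factorAt, List.range_succ, h2, h3]⟩⟩

theorem endsCount_two_zero : endsCount 2 0 = 2 := by
  obtain ⟨h0, h1, h2, h3, h4, h5, h6, h7, h8, h9, h10, h11, h12⟩ := thueMorse_values
  refine ncard_image_factorAt_eq_card (S := {[0, 1, 0], [1, 0, 1]}) (fun i hi => ?_) ?_
  · simp only [Set.mem_ofPred_eq] at hi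
    have hc := thueMorse_not_cube i
    simp only [factorAt, List.range_succ, List.range_zero, List.nil_append, List.cons_append,
      List.map_cons, List.map_nil, add_zero]
    generalize thueMorse i = a, thueMorse (i + 1) = b, thueMorse (i + 2) = c at *
    decide +revert
  · simp only [Finset.mem_insert, Finset.mem_singleton, forall_eq_or_imp, forall_eq]
    exact ⟨⟨3, by simp [h3, h5], by simp [factorAt, List.range_succ, h3, h4, h5]⟩,
      ⟨2, by simp [h2, h4]; decide, by simp [factorAt, List.range_succ, h2, h3, h4]⟩⟩

theorem endsCount_two_one : endsCount 2 1 = 4 := by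
  obtain ⟨h0, h1, h2, h3, h4, h5, h6, h7, h8, h9, h10, h11, h12⟩ := thueMorse_values
  refine ncard_image_factorAt_eq_card (S := {[0, 1, 1], [1, 0, 0], [1, 1, 0], [0, 0, 1]})
    (fun i hi => ?_) ?_
  · simp only [Set.mem_ofPred_eq] at hi
    simp only [factorAt, List.range_succ, List.range_zero, List.nil_append, List.cons_append,
      List.map_cons, List.map_nil, add_zero]
    generalize thueMorse i = a, thueMorse (i + 1) = b, thueMorse (i + 2) = c at *
    decide +revert
  · simp only [Finset.mem_insert, Finset.mem_singleton, forall_eq_or_imp, forall_eq]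
    exact ⟨⟨0, by simp [h0, h2], by simp [factorAt, List.range_succ, h0, h1, h2]⟩,
      ⟨4, by simp [h4, h6], by simp [factorAt, List.range_succ, h4, h5, h6]⟩,
      ⟨1, by simp [h1, h3], by simp [factorAt, List.range_succ, h1, h2, h3]⟩,
      ⟨5, by simp [h5, h7], by simp [factorAt, List.range_succ, h5, h6, h7]⟩⟩

/-! ### The excesses D and S. -/

/-- Three times the excess of `endsCount m 1` over `4 * m / 3`. -/
noncomputable def diffExcess (m : ℕ) : ℤ := 3 * endsCount m 1 - 4 * m

/-- Three times the excess of `endsCount m 0` over `4 * m / 3`. -/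
noncomputable def sameExcess (m : ℕ) : ℤ := 3 * endsCount m 0 - 4 * m

theorem diffExcess_two_mul {m : ℕ} (hm : 2 ≤ m) : diffExcess (2 * m) = 2 * diffExcess m := by
  rw [diffExcess, diffExcess, endsCount_two_mul hm]; push_cast; ring

theorem sameExcess_two_mul {m : ℕ} (hm : 2 ≤ m) : sameExcess (2 * m) = 2 * sameExcess m := by
  rw [sameExcess, sameExcess, endsCount_two_mul hm]; push_cast; ring

theorem diffExcess_two_mul_add_one {m : ℕ} (hm : 1 ≤ m) :
    diffExcess (2 * m + 1) = sameExcess m + sameExcess (m + 1) := by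
  rw [diffExcess, sameExcess, sameExcess, endsCount_two_mul_add_one hm,
    show (1 + 1 : ZMod 2) = 0 from rfl]; push_cast; ring

theorem sameExcess_two_mul_add_one {m : ℕ} (hm : 1 ≤ m) :
    sameExcess (2 * m + 1) = diffExcess m + diffExcess (m + 1) := by
  rw [sameExcess, diffExcess, diffExcess, endsCount_two_mul_add_one hm,
    show (0 + 1 : ZMod 2) = 1 from rfl]; push_cast; ring

theorem diffExcess_two : diffExcess 2 = 4 := by simp [diffExcess, endsCount_two_one]

theorem sameExcess_two : sameExcess 2 = -2 := by simp [sameExcess, endsCount_two_zero]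

theorem diffExcess_three : diffExcess 3 = 0 := by
  rw [show 3 = 2 * 1 + 1 by rfl, diffExcess_two_mul_add_one le_rfl, sameExcess_two]
  simp [sameExcess, endsCount_one_zero]

theorem sameExcess_three : sameExcess 3 = 6 := by
  rw [show 3 = 2 * 1 + 1 by rfl, sameExcess_two_mul_add_one le_rfl, diffExcess_two]
  simp [diffExcess, endsCount_one_one]

/-- Only D ≥ 0 is wanted in the end, but it is not inductive alone: D(2k+1) = S(k) + S(k+1) and
S(2k) + S(2k+1) = 2S(k) + D(k) + D(k+1). The three inequalities together are closed under the
recurrences. -/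
theorem excess_bounds (m : ℕ) (hm : 2 ≤ m) :
    0 ≤ diffExcess m ∧ 0 ≤ diffExcess m + 2 * sameExcess m ∧
      0 ≤ sameExcess m + sameExcess (m + 1) := by
  induction m using Nat.strong_induction_on with
  | _ m ih =>
  obtain ⟨k, rfl | rfl⟩ := Nat.even_or_odd' m
  · obtain rfl | hk : k = 1 ∨ 2 ≤ k := by omega
    · norm_num [diffExcess_two, sameExcess_two, sameExcess_three]
    · obtain ⟨h₁, h₂, h₃⟩ := ih k (by omega) hk
      obtain ⟨h₄, -, -⟩ | h : _ ∨ 2 * k ≤ k + 1 := by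
        by_cases h : k + 1 < 2 * k
        · exact Or.inl (ih (k + 1) h (by omega))
        · exact Or.inr (by omega)
      · rw [diffExcess_two_mul hk, sameExcess_two_mul hk, sameExcess_two_mul_add_one (by omega)]
        omega
      · omega
  · obtain rfl | hk : k = 1 ∨ 2 ≤ k := by omega
    · have h4 := sameExcess_two_mul (m := 2) le_rfl
      norm_num [diffExcess_three, sameExcess_two, sameExcess_three] at h4 ⊢
      rw [h4]; norm_num
    · obtain ⟨h₁, h₂, h₃⟩ := ih k (by omega) hk
      obtain ⟨h₄, h₅, -⟩ := ih (k + 1) (by omega) (by omega)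
      rw [diffExcess_two_mul_add_one (by omega), sameExcess_two_mul_add_one (by omega),
        show 2 * k + 1 + 1 = 2 * (k + 1) by ring, sameExcess_two_mul (by omega)]
      omega

/-- The value of S + D at 2k + 1 is the sum of its values at k and k + 1. It supplies the strictness
that excludes odd arguments in the next lemma. -/
theorem endsCount_add_pos (m : ℕ) (hm : 2 ≤ m) : 0 < sameExcess m + diffExcess m := by
  induction m using Nat.strong_induction_on with
  | _ m ih =>
  obtain ⟨k, rfl | rfl⟩ := Nat.even_or_odd' m
  · obtain rfl | hk : k = 1 ∨ 2 ≤ k := by omega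
    · norm_num [diffExcess_two, sameExcess_two]
    · have := ih k (by omega) hk
      rw [diffExcess_two_mul hk, sameExcess_two_mul hk]
      omega
  · obtain rfl | hk : k = 1 ∨ 2 ≤ k := by omega
    · norm_num [diffExcess_three, sameExcess_three]
    · have h₁ := ih k (by omega) hk
      have h₂ := ih (k + 1) (by omega) (by omega)
      rw [diffExcess_two_mul_add_one (by omega), sameExcess_two_mul_add_one (by omega)]
      omega

theorem eq_two_pow_of_excess_eq_zero (m : ℕ) (hm : 2 ≤ m)
    (h : diffExcess m + 2 * sameExcess m = 0) : ∃ k, 1 ≤ k ∧ m = 2 ^ k := by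
  induction m using Nat.strong_induction_on with
  | _ m ih =>
  obtain ⟨k, rfl | rfl⟩ := Nat.even_or_odd' m
  · obtain rfl | hk : k = 1 ∨ 2 ≤ k := by omega
    · exact ⟨1, le_rfl, rfl⟩
    · rw [diffExcess_two_mul hk, sameExcess_two_mul hk] at h
      obtain ⟨l, hl, rfl⟩ := ih k (by omega) hk (by omega)
      exact ⟨l + 1, by omega, by rw [pow_succ']⟩
  · obtain rfl | hk : k = 1 ∨ 2 ≤ k := by omega
    · norm_num [diffExcess_three, sameExcess_three] at h
    · have h₁ := excess_bounds k hk
      have h₂ := excess_bounds (k + 1) (by omega)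
      have h₃ := endsCount_add_pos k hk
      rw [diffExcess_two_mul_add_one (by omega), sameExcess_two_mul_add_one (by omega)] at h
      omega

theorem excess_two_pow (k : ℕ) (hk : 1 ≤ k) :
    diffExcess (2 ^ k) = 2 * 2 ^ k ∧ sameExcess (2 ^ k) = - 2 ^ k := by
  induction k, hk using Nat.le_induction with
  | base => norm_num [diffExcess_two, sameExcess_two]
  | succ k hk ih =>
    have : 2 ≤ 2 ^ k := le_self_pow₀ (by norm_num) (by omega)
    rw [pow_succ', diffExcess_two_mul this, sameExcess_two_mul this, ih.1, ih.2]
    constructor <;> ring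

/-- S(2^(k+1)) = −2^(k+1) cancels D(2^k) = 2^(k+1). Hence D(2^k + 1) depends only on the parity of
k, which is why J involves odd exponents only. -/
theorem diffExcess_two_pow_add_one_step (k : ℕ) (hk : 1 ≤ k) :
    diffExcess (2 ^ (k + 2) + 1) = diffExcess (2 ^ k + 1) := by
  have h2 : 1 ≤ 2 ^ k := Nat.one_le_two_pow
  rw [show 2 ^ (k + 2) + 1 = 2 * (2 * 2 ^ k) + 1 by ring, diffExcess_two_mul_add_one (by omega),
    sameExcess_two_mul_add_one h2, ← pow_succ', (excess_two_pow (k + 1) (by omega)).2,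
    (excess_two_pow k hk).1]
  ring

theorem diffExcess_five : diffExcess 5 = 4 := by
  rw [show 5 = 2 * 2 + 1 by rfl, diffExcess_two_mul_add_one (by norm_num), sameExcess_two]
  norm_num [sameExcess_three]

theorem diffExcess_two_pow_add_one (j : ℕ) :
    diffExcess (2 ^ (2 * j + 1) + 1) = 0 ∧ diffExcess (2 ^ (2 * j + 2) + 1) = 4 := by
  induction j with
  | zero => exact ⟨diffExcess_three, diffExcess_five⟩
  | succ j ih =>
    rw [show 2 * (j + 1) + 1 = 2 * j + 1 + 2 by ring, show 2 * (j + 1) + 2 = 2 * j + 2 + 2 by ring,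
      diffExcess_two_pow_add_one_step _ (by omega), diffExcess_two_pow_add_one_step _ (by omega)]
    exact ih

/-! ### The increment of factor complexity and the equality case for odd lengths. -/

/-- The number of factors of length `m + 2` minus the number of factors of length `m + 1`. -/
noncomputable def factorsIncrement (m : ℕ) : ℤ :=
  (endsCount (m + 1) 0 + endsCount (m + 1) 1) - (endsCount m 0 + endsCount m 1)

/-- Together with the odd case, this shows that the increment depends only on the two leading binary
digits of m: it is 4 for 10 and 2 for 11. -/
theorem factorsIncrement_two_mul {m : ℕ} (hm : 2 ≤ m) :
    factorsIncrement (2 * m) = factorsIncrement m := by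
  simp only [factorsIncrement, endsCount_two_mul hm,
    endsCount_two_mul_add_one (show 1 ≤ m by omega), show (1 + 1 : ZMod 2) = 0 from rfl, zero_add]
  push_cast; ring

theorem factorsIncrement_two_mul_add_one {m : ℕ} (hm : 2 ≤ m) :
    factorsIncrement (2 * m + 1) = factorsIncrement m := by
  simp only [factorsIncrement, endsCount_two_mul (show 2 ≤ m + 1 by omega),
    show 2 * m + 1 + 1 = 2 * (m + 1) by ring,
    endsCount_two_mul_add_one (show 1 ≤ m by omega), show (1 + 1 : ZMod 2) = 0 from rfl, zero_add]
  push_cast; ring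

theorem factorsIncrement_two : factorsIncrement 2 = 4 := by
  have h₁ := diffExcess_three
  have h₂ := sameExcess_three
  simp only [factorsIncrement, diffExcess, sameExcess, endsCount_two_zero, endsCount_two_one] at *
  push_cast at *
  omega

theorem factorsIncrement_three : factorsIncrement 3 = 2 := by
  have h₁ := diffExcess_three
  have h₂ := sameExcess_three
  simp only [factorsIncrement, diffExcess, sameExcess, show 3 + 1 = 2 * 2 by rfl,
    endsCount_two_mul le_rfl, endsCount_two_zero, endsCount_two_one] at *
  push_cast at *
  omega

theorem factorsIncrement_eq (m : ℕ) (hm : 2 ≤ m) :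
    factorsIncrement m = 2 ∨ factorsIncrement m = 4 := by
  induction m using Nat.strong_induction_on with
  | _ m ih =>
  obtain ⟨k, rfl | rfl⟩ := Nat.even_or_odd' m
  · obtain rfl | hk : k = 1 ∨ 2 ≤ k := by omega
    · exact Or.inr factorsIncrement_two
    · rw [factorsIncrement_two_mul hk]
      exact ih k (by omega) hk
  · obtain rfl | hk : k = 1 ∨ 2 ≤ k := by omega
    · exact Or.inl factorsIncrement_three
    · rw [factorsIncrement_two_mul_add_one hk]
      exact ih k (by omega) hk

theorem factorsIncrement_two_pow (k : ℕ) :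
    factorsIncrement (2 ^ (k + 1)) = 4 ∧ factorsIncrement (2 ^ (k + 2) - 1) = 2 ∧
      factorsIncrement (3 * 2 ^ k) = 2 := by
  induction k with
  | zero => exact ⟨factorsIncrement_two, factorsIncrement_three, factorsIncrement_three⟩
  | succ k ih =>
    have h2 : 1 ≤ 2 ^ k := Nat.one_le_two_pow
    have h4 : 2 ^ (k + 2) = 4 * 2 ^ k := by ring
    refine ⟨?_, ?_, ?_⟩
    · rw [pow_succ', factorsIncrement_two_mul (by rw [pow_succ']; omega), ih.1]
    · rw [show 2 ^ (k + 1 + 2) - 1 = 2 * (2 ^ (k + 2) - 1) + 1 by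
        rw [show 2 ^ (k + 1 + 2) = 2 * 2 ^ (k + 2) by ring]; omega,
        factorsIncrement_two_mul_add_one (by omega), ih.2.1]
    · rw [show 3 * 2 ^ (k + 1) = 2 * (3 * 2 ^ k) by ring, factorsIncrement_two_mul (by omega),
        ih.2.2]

theorem sameExcess_three_mul_two_pow (k : ℕ) : sameExcess (3 * 2 ^ k) = 6 * 2 ^ k := by
  induction k with
  | zero => exact sameExcess_three
  | succ k ih =>
    have h2 : 1 ≤ 2 ^ k := Nat.one_le_two_pow
    rw [show 3 * 2 ^ (k + 1) = 2 * (3 * 2 ^ k) by ring, sameExcess_two_mul (by omega), ih]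
    ring

/-- S(3·2^(k+1)) alone contributes the bound. It compensates for the at most four forbidden
extensions in the formula for odd lengths. -/
theorem diffExcess_six_mul_two_pow_add_one (k : ℕ) :
    12 * 2 ^ k ≤ diffExcess (2 * (3 * 2 ^ (k + 1)) + 1) := by
  have h2 : 1 ≤ 2 ^ k := Nat.one_le_two_pow
  have h : 2 ≤ 3 * 2 ^ k := by omega
  rw [diffExcess_two_mul_add_one (by rw [pow_succ']; omega), sameExcess_three_mul_two_pow,
    show 3 * 2 ^ (k + 1) + 1 = 2 * (3 * 2 ^ k) + 1 by ring,
    sameExcess_two_mul_add_one (by omega), pow_succ']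
  have := (excess_bounds _ h).1
  have := (excess_bounds (3 * 2 ^ k + 1) (by omega)).1
  omega

/-- For m = 2k, D(2m+1) = (D + 2S)(k) + D(k+1). Both terms must vanish, so k = 2^l, and D(2^l + 1) =
0 makes l odd. For m = 2k + 1 the sum is D(k) + (D + 2S)(k+1), so k + 1 is a power of two; then m is
one less than a power of two and its increment is 2, not 4. -/
theorem odd_excess_eq_zero_iff (m : ℕ) (hm : 4 ≤ m) :
    (diffExcess (2 * m + 1) = 0 ∧ factorsIncrement m = 4) ↔ ∃ j, 1 ≤ j ∧ m = 2 ^ (2 * j) := by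
  constructor
  · rintro ⟨h₁, h₂⟩
    rw [diffExcess_two_mul_add_one (by omega)] at h₁
    obtain ⟨k, rfl | rfl⟩ := Nat.even_or_odd' m
    · rw [sameExcess_two_mul (by omega), sameExcess_two_mul_add_one (by omega)] at h₁
      have := excess_bounds k (by omega)
      have := excess_bounds (k + 1) (by omega)
      obtain ⟨l, hl, rfl⟩ := eq_two_pow_of_excess_eq_zero k (by omega) (by omega)
      obtain ⟨j, rfl | rfl⟩ := Nat.even_or_odd' l
      · obtain ⟨i, rfl⟩ := Nat.exists_eq_add_of_le (show 1 ≤ j by omega)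
        have := (diffExcess_two_pow_add_one i).2
        rw [show 2 * i + 2 = 2 * (1 + i) by ring] at this
        omega
      · exact ⟨j + 1, by omega, by ring⟩
    · rw [sameExcess_two_mul_add_one (by omega), show 2 * k + 1 + 1 = 2 * (k + 1) by ring,
        sameExcess_two_mul (by omega)] at h₁
      have := excess_bounds k (by omega)
      have := excess_bounds (k + 1) (by omega)
      obtain ⟨l, hl, hk⟩ := eq_two_pow_of_excess_eq_zero (k + 1) (by omega) (by omega)
      obtain ⟨i, rfl⟩ := Nat.exists_eq_add_of_le hl
      have := (factorsIncrement_two_pow i).2.1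
      rw [show 2 ^ (i + 2) - 1 = 2 * k + 1 by
        rw [show 2 ^ (i + 2) = 2 * 2 ^ (1 + i) by ring, ← hk]; omega] at this
      omega
  · rintro ⟨j, hj, rfl⟩
    obtain ⟨i, rfl⟩ := Nat.exists_eq_add_of_le hj
    refine ⟨?_, ?_⟩
    · rw [← pow_succ', ← (diffExcess_two_pow_add_one (1 + i)).1]
    · rw [show 2 * (1 + i) = 2 * i + 1 + 1 by ring, (factorsIncrement_two_pow _).1]

/-! ### Rotations of μ-images and even lengths. -/

theorem isRotated_iff_append {α : Type*} {l l' : List α} :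
    l ~r l' ↔ ∃ u v, l = u ++ v ∧ l' = v ++ u := by
  constructor
  · rintro ⟨n, rfl⟩
    refine ⟨l.take (n % l.length), l.drop (n % l.length), (List.take_append_drop _ _).symm, ?_⟩
    rw [List.rotate_eq_drop_append_take_mod]
  · rintro ⟨u, v, rfl, rfl⟩
    exact List.isRotated_append

theorem thueMorseMap_isRotated {x y : List (ZMod 2)} (h : x ~r y) :
    thueMorseMap x ~r thueMorseMap y := by
  obtain ⟨u, v, rfl, rfl⟩ := isRotated_iff_append.mp h
  rw [thueMorseMap_append, thueMorseMap_append]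
  exact List.isRotated_append

theorem thueMorseMap_split_odd {x u v : List (ZMod 2)} (h : thueMorseMap x = u ++ v)
    (ho : ¬ Even u.length) :
    ∃ x₁ b x₂, x = x₁ ++ b :: x₂ ∧ u = thueMorseMap x₁ ++ [b] ∧
      v = (b + 1) :: thueMorseMap x₂ := by
  rcases List.eq_nil_or_concat' u with rfl | ⟨u, b, rfl⟩
  · simp at ho
  · rw [List.append_assoc] at h
    obtain ⟨x₁, x₂, rfl, rfl, h₂⟩ := thueMorseMap_split h (by
      rw [List.length_append, List.length_singleton, Nat.even_add_one, not_not] at ho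
      exact ho)
    rcases x₂ with _ | ⟨c, x₂⟩
    · cases h₂
    · simp only [thueMorseMap, List.singleton_append, List.cons.injEq] at h₂
      obtain ⟨rfl, rfl⟩ := h₂
      exact ⟨x₁, b, x₂, rfl, rfl, rfl⟩

theorem thueMorseMap_ne_append_square {x y : List (ZMod 2)} {a : ZMod 2} :
    thueMorseMap x ≠ thueMorseMap y ++ [a, a] := by
  intro h
  obtain ⟨-, x₂, -, -, h₂⟩ := thueMorseMap_split h (by rw [length_thueMorseMap]; simp)
  rcases x₂ with _ | ⟨c, _ | ⟨d, x₂⟩⟩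
  · cases h₂
  · simp only [thueMorseMap, List.cons.injEq] at h₂
    exact zmod_two_add_one_ne c (by rw [← h₂.2.1, ← h₂.1])
  · simp [thueMorseMap] at h₂

theorem eq_replicate_of_append {α : Type*} {l₁ l₂ : List α} {b : α} {n : ℕ}
    (h : l₂ ++ l₁ = List.replicate n b) :
    l₁ = List.replicate l₁.length b ∧ l₂ = List.replicate l₂.length b := by
  simp only [List.eq_replicate_iff, List.mem_append] at h ⊢
  exact ⟨⟨trivial, fun c hc => h.2 c (Or.inr hc)⟩, ⟨trivial, fun c hc => h.2 c (Or.inl hc)⟩⟩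

/-- A rotation between the images of two words under the Thue-Morse morphism comes from a rotation
of the words, unless the words are constant. -/
theorem isRotated_of_thueMorseMap {m : ℕ} (hm : 3 ≤ m) {x y : List (ZMod 2)}
    (hx : x ∈ factors thueMorse m) (h : thueMorseMap x ~r thueMorseMap y) : x ~r y := by
  obtain ⟨u, v, h₁, h₂⟩ := isRotated_iff_append.mp h
  by_cases he : Even u.length
  · obtain ⟨x₁, x₂, rfl, rfl, rfl⟩ := thueMorseMap_split h₁ he
    rw [← thueMorseMap_append] at h₂
    rw [thueMorseMap_injective h₂]
    exact List.isRotated_append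
  -- A cut inside a block misaligns the blocks, so x₂x₁ is constantly b. Then x = b^m, which
  -- contains a cube.
  · exfalso
    obtain ⟨x₁, b, x₂, rfl, rfl, rfl⟩ := thueMorseMap_split_odd h₁ he
    rw [List.cons_append, ← List.append_assoc, ← thueMorseMap_append] at h₂
    obtain ⟨h₃, -⟩ := cons_thueMorseMap_append_eq h₂.symm
    rw [zmod_two_add_one_add_one] at h₃
    obtain ⟨h₄, h₅⟩ := eq_replicate_of_append h₃
    have hl := length_of_mem_factors hx
    rw [List.length_append, List.length_cons] at hl
    rw [h₄, h₅, ← List.replicate_succ, ← List.replicate_add] at hx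
    have := le_two_of_replicate_mem_factors (u := []) (v := []) (by simpa using hx)
    omega

/-- The cyclic words with exactly one square of a letter that arise from factors of even length
at odd positions. -/
theorem append_square_isRotated {m : ℕ} (hm : 4 ≤ m) {y y' : List (ZMod 2)} {a a' : ZMod 2}
    (hy : (a + 1) :: (y ++ [a]) ∈ factors thueMorse (m + 1))
    (h : thueMorseMap y ++ [a, a] ~r thueMorseMap y' ++ [a', a']) : y = y' ∧ a = a' := by
  have hl : y.length + 1 = m := by
    have := length_of_mem_factors hy
    simp at this
    omega
  obtain ⟨u, v, h₁, h₂⟩ := isRotated_iff_append.mp h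
  have hlen := congrArg List.length h₁
  have hlen' := congrArg List.length h₂
  simp only [List.length_append, length_thueMorseMap, List.length_cons, List.length_nil]
    at hlen hlen'
  obtain hu | hu : u.length ≤ 2 * y.length ∨ 2 * y.length < u.length := by omega
  · obtain ⟨w, hw⟩ : ∃ w, thueMorseMap y = u ++ w := by
      rw [List.append_eq_append_iff] at h₁
      rcases h₁ with ⟨w, hw, -⟩ | ⟨w, hw, -⟩
      · have hwl := congrArg List.length hw
        rw [List.length_append, length_thueMorseMap] at hwl
        have : w = [] := List.length_eq_zero_iff.mp (by omega)
        exact ⟨[], by rw [hw, this]; simp⟩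
      · exact ⟨w, hw⟩
    rw [hw, List.append_assoc, List.append_cancel_left_eq] at h₁
    subst h₁
    by_cases he : Even u.length
    · obtain ⟨y₁, y₂, rfl, rfl, rfl⟩ := thueMorseMap_split hw he
      rcases List.eq_nil_or_concat' y₁ with rfl | ⟨y₁, d, rfl⟩
      · simp only [thueMorseMap, List.append_nil] at h₂
        obtain ⟨h₃, h₄⟩ := List.append_inj' h₂ rfl
        simp only [List.cons.injEq] at h₄
        exact ⟨(thueMorseMap_injective h₃).symm ▸ rfl, h₄.1.symm⟩
      -- The rotated word would end in the block d, d + 1 and not in a square.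
      · exfalso
        rw [thueMorseMap_append, thueMorseMap_singleton, ← List.append_assoc] at h₂
        obtain ⟨-, h₄⟩ := List.append_inj' h₂ rfl
        simp only [List.cons.injEq] at h₄
        exact zmod_two_add_one_ne d (by rw [← h₄.2.1, ← h₄.1])
    · exfalso
      -- Misalignment on both sides of the square forces y₁ = (a+1)^p and y₂ = a^q. The factor in
      -- `hy` is then (a+1)^(p+1) a^(q+2), and both runs have length at most 2, contradicting m ≥ 4.
      obtain ⟨y₁, b, y₂, rfl, rfl, rfl⟩ := thueMorseMap_split_odd hw he
      rw [show thueMorseMap y' ++ [a', a'] = thueMorseMap y' ++ [a'] ++ [a'] by simp,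
        ← List.append_assoc, append_singleton_inj] at h₂
      obtain ⟨h₂, rfl⟩ := h₂
      rw [show (a' + 1) :: thueMorseMap y₂ ++ [a, a] ++ thueMorseMap y₁ =
        (a' + 1) :: (thueMorseMap y₂ ++ [a]) ++ a :: thueMorseMap y₁ by simp] at h₂
      obtain ⟨z₁, hz⟩ : ∃ z₁, a :: thueMorseMap y₁ = z₁ ++ [a'] := by
        refine ⟨(a :: thueMorseMap y₁).dropLast, ?_⟩
        have := congrArg List.getLast? h₂
        rw [List.getLast?_concat, List.getLast?_append_of_ne_nil _ (by simp), eq_comm,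
          List.getLast?_eq_some_iff] at this
        obtain ⟨z, hz⟩ := this
        rw [hz, List.dropLast_concat]
      rw [hz, ← List.append_assoc, append_singleton_inj] at h₂
      obtain ⟨w₁, w₂, rfl, h₅, rfl⟩ := thueMorseMap_split h₂.1
        (by simp [length_thueMorseMap, Nat.even_add_one])
      obtain ⟨h₆, h₇⟩ := cons_thueMorseMap_append_eq h₅
      obtain ⟨h₈, -, -⟩ := cons_thueMorseMap_eq hz
      rw [zmod_two_add_one_add_one] at h₆ h₇
      subst h₇
      rw [List.length_append, List.length_cons] at hl
      rw [h₆, h₈] at hy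
      have h₉ := le_two_of_replicate_mem_factors (u := []) (k := y₁.length + 1) (a := a + 1)
        (v := List.replicate (y₂.length + 2) a) (n := m + 1) (by
          convert hy using 1
          simp [List.replicate_succ, ← List.replicate_succ'])
      have h₁₀ := le_two_of_replicate_mem_factors (u := List.replicate (y₁.length + 1) (a + 1))
        (v := []) (k := y₂.length + 2) (a := a) (n := m + 1) (by
          convert hy using 1
          simp [List.replicate_succ, ← List.replicate_succ'])
      omega
  · rw [show thueMorseMap y ++ [a, a] = thueMorseMap y ++ [a] ++ [a] by simp] at h₁
    obtain hv | hv : v.length = 0 ∨ v.length = 1 := by omega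
    · rw [List.length_eq_zero_iff] at hv
      subst hv
      rw [List.append_nil] at h₁
      rw [← h₁, List.nil_append,
        show thueMorseMap y' ++ [a', a'] = thueMorseMap y' ++ [a'] ++ [a'] by simp,
        append_singleton_inj, append_singleton_inj] at h₂
      exact ⟨(thueMorseMap_injective h₂.1.1).symm, h₂.2.symm⟩
    -- Cutting between the two equal letters gives a μ(y) a, which makes y constantly a + 1; with
    -- the letter before it this is a run of length m.
    · exfalso
      rw [List.length_eq_one_iff] at hv
      obtain ⟨c, rfl⟩ := hv
      rw [append_singleton_inj] at h₁
      obtain ⟨rfl, rfl⟩ := h₁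
      rw [show thueMorseMap y' ++ [a', a'] = thueMorseMap y' ++ [a'] ++ [a'] by simp,
        ← List.append_assoc, append_singleton_inj, List.singleton_append] at h₂
      obtain ⟨h₃, -⟩ := cons_thueMorseMap_eq h₂.1.symm
      rw [h₃, ← List.cons_append, ← List.replicate_succ] at hy
      have := le_two_of_replicate_mem_factors (u := []) (by simpa using hy)
      omega

theorem append_square_not_isRotated {x y : List (ZMod 2)} {a : ZMod 2}
    (h : thueMorseMap x ~r thueMorseMap y ++ [a, a]) : False := by
  obtain ⟨u, v, h₁, h₂⟩ := isRotated_iff_append.mp h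
  by_cases he : Even u.length
  · obtain ⟨x₁, x₂, rfl, rfl, rfl⟩ := thueMorseMap_split h₁ he
    rw [← thueMorseMap_append] at h₂
    exact thueMorseMap_ne_append_square h₂.symm
  · obtain ⟨x₁, b, x₂, rfl, rfl, rfl⟩ := thueMorseMap_split_odd h₁ he
    rw [List.cons_append, ← List.append_assoc, ← thueMorseMap_append,
      show thueMorseMap y ++ [a, a] = thueMorseMap y ++ [a] ++ [a] by simp,
      ← List.cons_append, append_singleton_inj] at h₂
    obtain ⟨-, h₃, -⟩ := cons_thueMorseMap_eq h₂.1.symm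
    exact zmod_two_add_one_ne b (by rw [← h₃, h₂.2])

/-- Even positions give the cycles of μ(x), one for each cyclic class of factors x of length m. An
odd position gives a word bμ(z)a, which rotates to μ(z)ab. If b = a + 1 this is again a μ-image; if
b = a it is a new cycle marked by the square aa, and such cycles are in bijection with factors of
length m + 1 with distinct ends. -/
theorem cyclicComplexity_two_mul {m : ℕ} (hm : 4 ≤ m) :
    cyclicComplexity thueMorse (2 * m) = cyclicComplexity thueMorse m + endsCount m 1 := by
  obtain ⟨l, rfl⟩ := Nat.exists_eq_add_of_le' (show 1 ≤ m by omega)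
  set s : Set ℕ := {i | thueMorse i + thueMorse (i + (l + 1)) = 1}
  set f : ℕ → Cycle (ZMod 2) := fun i =>
    ((thueMorseMap (factorAt thueMorse (i + 1) l) ++
      [thueMorse (i + (l + 1)), thueMorse (i + (l + 1))] : List (ZMod 2)) : Cycle (ZMod 2))
  have hodd : ∀ i, ((factorAt thueMorse (2 * i + 1) (2 * (l + 1)) : List (ZMod 2)) :
      Cycle (ZMod 2)) = ((thueMorseMap (factorAt thueMorse (i + 1) l) ++
        [thueMorse (i + (l + 1)), thueMorse i + 1] : List (ZMod 2)) : Cycle (ZMod 2)) := by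
    intro i
    rw [Cycle.coe_eq_coe, show 2 * (l + 1) = 2 * l + 2 by ring, factorAt_thueMorse_odd_even,
      show i + 1 + l = i + (l + 1) by ring]
    refine isRotated_iff_append.mpr ⟨[thueMorse i + 1], _, List.singleton_append.symm, ?_⟩
    simp
  have hset : (fun w : List (ZMod 2) => (w : Cycle (ZMod 2))) '' factors thueMorse (2 * (l + 1)) =
      (fun w : List (ZMod 2) => (thueMorseMap w : Cycle (ZMod 2))) '' factors thueMorse (l + 1) ∪
        f '' s := by
    ext c
    constructor
    · rintro ⟨_, ⟨i, rfl⟩, rfl⟩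
      obtain ⟨k, rfl | rfl⟩ := Nat.even_or_odd' i
      · exact Or.inl ⟨_, ⟨k, rfl⟩, by simp only [thueMorseMap_factorAt]⟩
      · by_cases hk : k ∈ s
        · refine Or.inr ⟨k, hk, ?_⟩
          simp only [hodd, f]
          rw [zmod_two_add_eq_one_iff.mp hk, zmod_two_add_one_add_one]
        · refine Or.inl ⟨factorAt thueMorse (k + 1) (l + 1), ⟨_, rfl⟩, ?_⟩
          have : thueMorse k = thueMorse (k + (l + 1)) := by
            by_contra hne
            exact hk (zmod_two_add_eq_one_iff.mpr (zmod_two_eq_add_one_of_ne hne))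
          simp only [hodd]
          rw [this, factorAt_succ_right, thueMorseMap_append, thueMorseMap_singleton,
            show k + 1 + l = k + (l + 1) by ring]
    · rintro (⟨_, ⟨k, rfl⟩, rfl⟩ | ⟨k, hk, rfl⟩)
      · exact ⟨_, ⟨2 * k, rfl⟩, by simp only [thueMorseMap_factorAt]⟩
      · refine ⟨_, ⟨2 * k + 1, rfl⟩, ?_⟩
        simp only [hodd, f]
        rw [zmod_two_add_eq_one_iff.mp hk, zmod_two_add_one_add_one]
  have hfin : (factors thueMorse (l + 1)).Finite := finite_factors _ _
  have hfin' : (f '' s).Finite :=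
    (finite_cyclic_factors thueMorse (2 * (l + 1))).subset
      (hset ▸ Set.subset_union_right)
  rw [cyclicComplexity, hset, Set.ncard_union_eq _ (hfin.image _) hfin', cyclicComplexity,
    endsCount]
  · congr 1
    · conv_lhs => rw [← Set.image_id (factors thueMorse (l + 1))]
      refine ncard_image_congr fun x hx y hy => ?_
      rw [Cycle.coe_eq_coe, Cycle.coe_eq_coe]
      exact ⟨isRotated_of_thueMorseMap (by omega) hx, thueMorseMap_isRotated⟩
    · conv_lhs => rw [← Set.image_id s]
      refine ncard_image_congr fun i hi j hj => ?_
      have hform : ∀ i ∈ s, factorAt thueMorse i (l + 1 + 1) =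
          (thueMorse (i + (l + 1)) + 1) ::
            (factorAt thueMorse (i + 1) l ++ [thueMorse (i + (l + 1))]) := by
        intro i hi
        rw [factorAt_succ, factorAt_succ_right, zmod_two_add_eq_one_iff.mp hi,
          show i + 1 + l = i + (l + 1) by ring]
      rw [hform i hi, hform j hj]
      simp only [f, id, Cycle.coe_eq_coe]
      constructor
      · intro h
        obtain ⟨h₁, h₂⟩ := append_square_isRotated hm (hform i hi ▸ ⟨i, rfl⟩) h
        rw [h₁, h₂]
      · intro h
        rw [List.cons.injEq, append_singleton_inj] at h
        rw [h.2.1, h.2.2]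
  · rw [Set.disjoint_left]
    rintro _ ⟨x, hx, rfl⟩ ⟨i, hi, h⟩
    simp only [f, Cycle.coe_eq_coe] at h
    exact append_square_not_isRotated h.symm

/-! ### Forbidden two-sided extensions. -/

/-- The pairs `(x, a)` such that `(a + δ) x` and `x a` are factors of the Thue-Morse word, but
`(a + δ) x a` is not. -/
def forbiddenExtensions (δ : ZMod 2) (m : ℕ) : Set (List (ZMod 2) × ZMod 2) :=
  {p | (p.2 + δ) :: p.1 ∈ factors thueMorse (m + 1) ∧ p.1 ++ [p.2] ∈ factors thueMorse (m + 1) ∧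
    (p.2 + δ) :: (p.1 ++ [p.2]) ∉ factors thueMorse (m + 2)}

theorem parity_eq_of_factorAt_eq {i j n : ℕ} (hn : 4 ≤ n)
    (h : factorAt thueMorse i n = factorAt thueMorse j n) :
    (∃ k l, i = 2 * k ∧ j = 2 * l) ∨ ∃ k l, i = 2 * k + 1 ∧ j = 2 * l + 1 := by
  obtain ⟨k, rfl | rfl⟩ := Nat.even_or_odd' i <;> obtain ⟨l, rfl | rfl⟩ := Nat.even_or_odd' j
  · exact Or.inl ⟨k, l, rfl, rfl⟩
  · exact (factorAt_even_ne_odd hn h).elim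
  · exact (factorAt_even_ne_odd hn h.symm).elim
  · exact Or.inr ⟨k, l, rfl, rfl⟩

theorem cons_append_factorAt {α : Type*} (x : ℕ → α) (i n : ℕ) :
    x i :: (factorAt x (i + 1) n ++ [x (i + 1 + n)]) = factorAt x i (n + 2) := by
  rw [← factorAt_succ_right, ← factorAt_succ]

/-- The occurrences of x have a common parity, and an odd-length x cuts a block at exactly one end.
The neighbouring letter there is determined by x, so the two one-sided extensions combine. -/
theorem forbiddenExtensions_odd (δ : ZMod 2) {l : ℕ} (hl : 2 ≤ l) :
    forbiddenExtensions δ (2 * l + 1) = ∅ := by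
  rw [Set.eq_empty_iff_forall_notMem]
  rintro ⟨x, a⟩ ⟨h₁, h₂, h₃⟩
  obtain ⟨i, hi, rfl⟩ := cons_mem_factors_iff.mp h₁
  obtain ⟨j, hj, ha⟩ := append_mem_factors_iff.mp h₂
  dsimp only at hi hj ha h₃
  have hag := factorAt_eq_iff.mp hj
  apply h₃
  obtain ⟨k, q, hk, rfl⟩ | ⟨k, q, hk, rfl⟩ := parity_eq_of_factorAt_eq (by omega) hj
  · refine ⟨i, ?_⟩
    rw [← cons_append_factorAt, hi, ← ha]
    congr 3
    have := hag (2 * l) (by omega)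
    rw [hk, ← mul_add, ← mul_add, thueMorse_two_mul, thueMorse_two_mul] at this
    rw [hk, ← add_assoc, ← add_assoc, ← mul_add, ← mul_add, thueMorse_two_mul_add_one,
      thueMorse_two_mul_add_one, this]
  · refine ⟨2 * q, ?_⟩
    rw [← cons_append_factorAt, ← ha, ← hj, ← hi.trans (congrArg (· + δ) ha.symm)]
    congr 1
    have := hag 0 (by omega)
    rw [add_zero, add_zero, hk, thueMorse_two_mul_add_one, thueMorse_two_mul_add_one] at this
    obtain rfl : i = 2 * k := by omega
    rw [thueMorse_two_mul, thueMorse_two_mul, add_right_cancel this]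

/-- If x starts at odd positions, its outer neighbours are determined and nothing is forbidden.
Otherwise x = μ(x'), and the preceding letter is the complement of the one before x', which flips δ.
-/
theorem forbiddenExtensions_even (δ : ZMod 2) {l : ℕ} (hl : 2 ≤ l) :
    forbiddenExtensions δ (2 * l) ⊆
      (fun p => (thueMorseMap p.1, p.2)) '' forbiddenExtensions (δ + 1) l := by
  rintro ⟨x, a⟩ ⟨h₁, h₂, h₃⟩
  obtain ⟨i, hi, rfl⟩ := cons_mem_factors_iff.mp h₁
  obtain ⟨j, hj, ha⟩ := append_mem_factors_iff.mp h₂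
  dsimp only at hi hj ha h₃
  have hag := factorAt_eq_iff.mp hj
  obtain ⟨k, q, hk, rfl⟩ | ⟨k, q, hk, rfl⟩ := parity_eq_of_factorAt_eq (by omega) hj
  · obtain ⟨r, rfl⟩ := Nat.exists_eq_add_of_le' (show 1 ≤ k by omega)
    obtain rfl : i = 2 * r + 1 := by omega
    rw [← mul_add, thueMorse_two_mul] at ha
    rw [thueMorse_two_mul_add_one] at hi
    have hr : thueMorse r = a + (δ + 1) := by
      rw [← add_assoc, ← hi, zmod_two_add_one_add_one]
    rw [hk] at hj h₃ ⊢
    refine ⟨(factorAt thueMorse (r + 1) l, a), ⟨?_, ?_, ?_⟩, ?_⟩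
    · dsimp only
      rw [← hr, ← factorAt_succ]
      exact factorAt_mem_factors _ _ _
    · dsimp only
      rw [factorAt_even_even_eq_iff.mp hj, ← ha, ← factorAt_succ_right]
      exact factorAt_mem_factors _ _ _
    · dsimp only
      intro h
      obtain ⟨s, hs, h⟩ := cons_mem_factors_iff.mp h
      rw [factorAt_succ_right, append_singleton_inj] at h
      apply h₃
      refine ⟨2 * s + 1, ?_⟩
      rw [← thueMorseMap_factorAt, h.1, h.2, factorAt_thueMorse_odd_even, hs, ← add_assoc a δ 1,
        zmod_two_add_one_add_one]
      rw [h.2]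
    · dsimp only
      rw [thueMorseMap_factorAt]
  · exfalso
    apply h₃
    refine ⟨i, ?_⟩
    rw [← cons_append_factorAt, hi, ← ha]
    congr 3
    have := hag (2 * l - 1) (by omega)
    rw [hk, show 2 * k + 1 + (2 * l - 1) = 2 * (k + l) by omega,
      show 2 * q + 1 + (2 * l - 1) = 2 * (q + l) by omega, thueMorse_two_mul,
      thueMorse_two_mul] at this
    rw [hk, show 2 * k + 1 + 2 * l = 2 * (k + l) + 1 by omega,
      show 2 * q + 1 + 2 * l = 2 * (q + l) + 1 by omega, thueMorse_two_mul_add_one,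
      thueMorse_two_mul_add_one, this]

theorem cons_three_not_cube {n : ℕ} {a b c : ZMod 2} {u v : List (ZMod 2)}
    (h : u ++ a :: b :: c :: v ∈ factors thueMorse n) : ¬ (a = b ∧ b = c) := by
  rintro ⟨rfl, rfl⟩
  exact replicate_three_notMem_factors (u := u) (v := v) (a := a)
    (by simpa [List.replicate] using h)

theorem exists_four_eq_thueMorse (a b c d : ZMod 2) (h₁ : ¬ (a = b ∧ b = c))
    (h₂ : ¬ (b = c ∧ c = d)) : [a, b, c, d] ∈ factors thueMorse 4 := by
  have : ∃ i < 12, [a, b, c, d] = factorAt thueMorse i 4 := by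
    decide +revert
  obtain ⟨i, -, hi⟩ := this
  exact ⟨i, hi⟩

/-- The hypothesis `h₄` leaves out only words of the form abcba with b ≠ c. All others that are
cube-free already occur among the first twelve positions. -/
theorem exists_five_eq_thueMorse (a b c d e : ZMod 2) (h₁ : ¬ (a = b ∧ b = c))
    (h₂ : ¬ (b = c ∧ c = d)) (h₃ : ¬ (c = d ∧ d = e)) (h₄ : a ≠ e ∨ b = c ∨ c = d) :
    [a, b, c, d, e] ∈ factors thueMorse 5 := by
  have : ∃ i < 12, [a, b, c, d, e] = factorAt thueMorse i 5 := by
    decide +revert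
  obtain ⟨i, -, hi⟩ := this
  exact ⟨i, hi⟩

theorem forbiddenExtensions_two (δ : ZMod 2) : forbiddenExtensions δ 2 = ∅ := by
  rw [Set.eq_empty_iff_forall_notMem]
  rintro ⟨x, a⟩ ⟨h₁, h₂, h₃⟩
  have hx := length_of_mem_factors h₁
  obtain ⟨b, c, rfl⟩ : ∃ b c, x = [b, c] := by
    rw [← List.length_eq_two]
    simpa using hx
  exact h₃ (exists_four_eq_thueMorse _ _ _ _ (cons_three_not_cube (u := []) (v := []) h₁)
    (cons_three_not_cube (u := []) (v := []) h₂))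

theorem forbiddenExtensions_three (δ : ZMod 2) :
    forbiddenExtensions δ 3 = ∅ ∨ δ = 0 ∧ (forbiddenExtensions δ 3).ncard ≤ 4 := by
  have key : ∀ p ∈ forbiddenExtensions δ 3, δ = 0 ∧ p ∈ (({([0, 1, 0], 0), ([0, 1, 0], 1),
      ([1, 0, 1], 0), ([1, 0, 1], 1)} : Finset (List (ZMod 2) × ZMod 2)) : Set _) := by
    rintro ⟨x, a⟩ ⟨h₁, h₂, h₃⟩
    have hx := length_of_mem_factors h₁
    obtain ⟨b, c, d, rfl⟩ : ∃ b c d, x = [b, c, d] := by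
      rw [← List.length_eq_three]
      simpa using hx
    have h : ¬ (a + δ ≠ a ∨ b = c ∨ c = d) := fun h₄ => h₃ (exists_five_eq_thueMorse _ _ _ _ _
      (cons_three_not_cube (u := []) (v := [d]) h₁) (cons_three_not_cube (u := []) (v := [a]) h₂)
      (cons_three_not_cube (u := [b]) (v := []) h₂) h₄)
    rw [Finset.mem_coe]
    clear h₁ h₂ h₃ hx
    decide +revert
  rcases Set.eq_empty_or_nonempty (forbiddenExtensions δ 3) with h | ⟨p, hp⟩
  · exact Or.inl h
  · exact Or.inr ⟨(key p hp).1, (Set.ncard_le_ncard (fun q hq => (key q hq).2)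
      (Finset.finite_toSet _)).trans (by rw [Set.ncard_coe_finset]; decide)⟩

theorem finite_forbiddenExtensions (δ : ZMod 2) (m : ℕ) : (forbiddenExtensions δ m).Finite := by
  refine Set.Finite.of_finite_image (f := fun p => p.1 ++ [p.2])
    ((finite_factors thueMorse (m + 1)).subset ?_) ?_
  · rintro _ ⟨p, hp, rfl⟩
    exact hp.2.1
  · rintro ⟨x, a⟩ - ⟨y, b⟩ - h
    obtain ⟨rfl, rfl⟩ := append_singleton_inj.mp h
    rfl

/-- Halving m flips δ and ends in an empty case unless it reaches length 3 with δ = 0. The bound 4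
comes from there and passes up through the inclusions. -/
theorem forbiddenExtensions_eq_empty_or (m : ℕ) (hm : 2 ≤ m) (δ : ZMod 2) :
    forbiddenExtensions δ m = ∅ ∨
      ∃ k : ℕ, m = 3 * 2 ^ k ∧ δ = k ∧ (forbiddenExtensions δ m).ncard ≤ 4 := by
  induction m using Nat.strong_induction_on generalizing δ with
  | _ m ih =>
  obtain ⟨l, rfl | rfl⟩ := Nat.even_or_odd' m
  · obtain rfl | hl : l = 1 ∨ 2 ≤ l := by omega
    · exact Or.inl (forbiddenExtensions_two δ)
    · have hsub := forbiddenExtensions_even δ hl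
      obtain h | ⟨k, rfl, hδ, hc⟩ := ih l (by omega) hl (δ + 1)
      · rw [h, Set.image_empty] at hsub
        exact Or.inl (Set.subset_empty_iff.mp hsub)
      · refine Or.inr ⟨k + 1, by ring, ?_, ?_⟩
        · rw [Nat.cast_add, ← hδ, Nat.cast_one, zmod_two_add_one_add_one]
        · have hf := finite_forbiddenExtensions (δ + 1) (3 * 2 ^ k)
          exact (Set.ncard_le_ncard hsub (hf.image _)).trans ((Set.ncard_image_le hf).trans hc)
  · obtain rfl | hl : l = 1 ∨ 2 ≤ l := by omega
    · exact (forbiddenExtensions_three δ).imp id fun h => ⟨0, rfl, by simpa using h.1, h.2⟩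
    · exact Or.inl (forbiddenExtensions_odd δ hl)

/-! ### Odd lengths. -/

/-- The pairs `(y, a)` such that the cyclic words `μ(y) a`, with `μ` the Thue-Morse morphism, are
those of the factors of length `2 * m + 1` of the Thue-Morse word. -/
def oddRepresentatives (m : ℕ) : Set (List (ZMod 2) × ZMod 2) :=
  {p | p.1 ++ [p.2] ∈ factors thueMorse (m + 1) ∨ (p.2 + 1) :: p.1 ∈ factors thueMorse (m + 1)}

/-- The representatives `(y, a)` that do not have the form `((a + 1) x, a)` for another
representative `(x a, a)`. -/
def terminalRepresentatives (m : ℕ) : Set (List (ZMod 2) × ZMod 2) :=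
  {p ∈ oddRepresentatives m | ∀ x, p.1 = (p.2 + 1) :: x →
    (x ++ [p.2], p.2) ∉ oddRepresentatives m}

/-- The cyclic word represented by a pair `(y, a)`. -/
def oddCycle (p : List (ZMod 2) × ZMod 2) : Cycle (ZMod 2) :=
  ((thueMorseMap p.1 ++ [p.2] : List (ZMod 2)) : Cycle (ZMod 2))

theorem append_pair_injective {α : Type*} :
    Function.Injective fun p : List α × α => p.1 ++ [p.2] := by
  rintro ⟨x, a⟩ ⟨y, b⟩ h
  obtain ⟨rfl, rfl⟩ := append_singleton_inj.mp h
  rfl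

theorem finite_oddRepresentatives (m : ℕ) : (oddRepresentatives m).Finite := by
  refine Set.Finite.union ?_ ?_
  · exact Set.Finite.preimage (f := fun p : List (ZMod 2) × ZMod 2 => p.1 ++ [p.2])
      append_pair_injective.injOn (finite_factors thueMorse (m + 1))
  · refine Set.Finite.preimage (f := fun p : List (ZMod 2) × ZMod 2 => (p.2 + 1) :: p.1)
      (Function.Injective.injOn ?_) (finite_factors thueMorse (m + 1))
    rintro ⟨x, a⟩ ⟨y, b⟩ h
    simp only [List.cons.injEq, add_left_inj] at h
    rw [h.1, h.2]

theorem image_factors_odd (m : ℕ) :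
    (fun w : List (ZMod 2) => (w : Cycle (ZMod 2))) '' factors thueMorse (2 * m + 1) =
      oddCycle '' oddRepresentatives m := by
  have hodd : ∀ i, ((factorAt thueMorse (2 * i + 1) (2 * m + 1) : List (ZMod 2)) :
      Cycle (ZMod 2)) = oddCycle (factorAt thueMorse (i + 1) m, thueMorse i + 1) := by
    intro i
    rw [oddCycle, Cycle.coe_eq_coe, factorAt_thueMorse_odd_odd]
    exact isRotated_iff_append.mpr ⟨[thueMorse i + 1], _, List.singleton_append.symm, rfl⟩
  have heven : ∀ i, ((factorAt thueMorse (2 * i) (2 * m + 1) : List (ZMod 2)) :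
      Cycle (ZMod 2)) = oddCycle (factorAt thueMorse i m, thueMorse (i + m)) := by
    intro i
    rw [oddCycle, factorAt_thueMorse_even_odd]
  ext c
  constructor
  · rintro ⟨_, ⟨i, rfl⟩, rfl⟩
    obtain ⟨k, rfl | rfl⟩ := Nat.even_or_odd' i
    · exact ⟨_, Or.inl ⟨k, (factorAt_succ_right _ _ _).symm⟩, (heven k).symm⟩
    · refine ⟨_, Or.inr ⟨k, ?_⟩, (hodd k).symm⟩
      rw [factorAt_succ, zmod_two_add_one_add_one]
  · rintro ⟨⟨y, a⟩, h | h, rfl⟩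
    · obtain ⟨i, rfl, rfl⟩ := append_mem_factors_iff.mp h
      exact ⟨_, ⟨2 * i, rfl⟩, heven i⟩
    · obtain ⟨i, hi, rfl⟩ := cons_mem_factors_iff.mp h
      refine ⟨_, ⟨2 * i + 1, rfl⟩, (hodd i).trans ?_⟩
      rw [hi, zmod_two_add_one_add_one]

/-- Moving the last two letters of μ(x) a (a+1) a to the front yields μ((a+1)x) a. Iterates of this
step account for all coincidences between representatives. -/
theorem oddCycle_step (x : List (ZMod 2)) (a : ZMod 2) :
    oddCycle (x ++ [a], a) = oddCycle ((a + 1) :: x, a) := by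
  rw [oddCycle, oddCycle, Cycle.coe_eq_coe, isRotated_iff_append]
  refine ⟨thueMorseMap x ++ [a], [a + 1, a], ?_, ?_⟩
  · simp [thueMorseMap_append, thueMorseMap_singleton]
  · simp [thueMorseMap, zmod_two_add_one_add_one]

theorem image_terminalRepresentatives (m : ℕ) :
    oddCycle '' terminalRepresentatives m = oddCycle '' oddRepresentatives m := by
  refine (Set.image_mono fun p hp => hp.1).antisymm ?_
  suffices ∀ n, ∀ p ∈ oddRepresentatives m, p.1.count (p.2 + 1) = n →
      ∃ q ∈ terminalRepresentatives m, oddCycle q = oddCycle p by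
    rintro _ ⟨p, hp, rfl⟩
    exact this _ p hp rfl
  intro n
  -- Each backward step removes one letter a + 1 from y, so the process stops at a terminal
  -- representative.
  induction n with
  | zero =>
    rintro ⟨y, a⟩ hp hn
    refine ⟨_, ⟨hp, ?_⟩, rfl⟩
    intro x hx
    rw [hx] at hn
    simp at hn
  | succ n ih =>
    rintro ⟨y, a⟩ hp hn
    by_cases ht : (y, a) ∈ terminalRepresentatives m
    · exact ⟨_, ht, rfl⟩
    · obtain ⟨x, rfl, hx⟩ : ∃ x, y = (a + 1) :: x ∧ (x ++ [a], a) ∈ oddRepresentatives m := by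
        by_contra! hcon
        exact ht ⟨hp, hcon⟩
      obtain ⟨q, hq, h⟩ := ih _ hx (by
        have : a ≠ a + 1 := (zmod_two_add_one_ne a).symm
        simpa [List.count_append, List.count_singleton, this] using hn)
      exact ⟨q, hq, h.trans (oddCycle_step x a)⟩

/-- An even cut makes aμ(y₁) overlap a μ-image, so the prefix y₁ of y is constant; the rotation is
thus a k-fold iterate of `oddCycle_step`. As the total length is odd, one of the two pieces always
has even length. -/
theorem exists_replicate_of_append {y y' u v : List (ZMod 2)} {a a' : ZMod 2}
    (h₁ : thueMorseMap y ++ [a] = u ++ v) (h₂ : thueMorseMap y' ++ [a'] = v ++ u)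
    (hu : Even u.length) :
    ∃ k w, a' = a ∧ y = List.replicate k (a + 1) ++ w ∧ y' = w ++ List.replicate k a := by
  obtain ⟨w, hw, rfl⟩ : ∃ w, thueMorseMap y = u ++ w ∧ v = w ++ [a] := by
    rw [List.append_eq_append_iff] at h₁
    rcases h₁ with ⟨w, hw, hw'⟩ | ⟨w, hw, hw'⟩
    · have hwl := congrArg List.length hw
      have hwl' := congrArg List.length hw'
      simp only [List.length_append, length_thueMorseMap, List.length_singleton] at hwl hwl'
      obtain ⟨r, hr⟩ := hu
      obtain rfl : w = [] := List.length_eq_zero_iff.mp (by omega)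
      exact ⟨[], by simpa using hw.symm, by simpa using hw'.symm⟩
    · exact ⟨w, hw, hw'⟩
  obtain ⟨y₁, y₂, rfl, rfl, rfl⟩ := thueMorseMap_split hw hu
  obtain ⟨w, hw', h⟩ : ∃ w, thueMorseMap y' = thueMorseMap y₂ ++ w ∧
      a :: thueMorseMap y₁ = w ++ [a'] := by
    rw [List.append_assoc, List.singleton_append, List.append_eq_append_iff] at h₂
    rcases h₂ with ⟨w, h₃, h₄⟩ | ⟨w, h₃, h₄⟩
    · rcases w with _ | ⟨c, w⟩
      · exact ⟨[], by simpa using h₃.symm, by simpa using h₄.symm⟩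
      · simp at h₄
    · exact ⟨w, h₃, h₄⟩
  obtain ⟨z₁, z₂, rfl, hz₁, rfl⟩ := thueMorseMap_split hw' (by rw [length_thueMorseMap]; simp)
  obtain ⟨h₃, h₄, h₅⟩ := cons_thueMorseMap_eq h
  exact ⟨y₁.length, y₂, h₄, by rw [← h₃], by rw [← h₅, thueMorseMap_injective hz₁]⟩

theorem eq_of_mem_terminalRepresentatives {m k : ℕ} {w : List (ZMod 2)} {a : ZMod 2}
    (hp : (List.replicate k (a + 1) ++ w, a) ∈ terminalRepresentatives m)
    (hq : (w ++ List.replicate k a, a) ∈ oddRepresentatives m) : k = 0 := by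
  obtain ⟨hp, ht⟩ := hp
  rcases k with _ | _ | k
  · rfl
  · exact (ht w rfl hq).elim
  · exfalso
    have hx := ht (List.replicate (k + 1) (a + 1) ++ w) (by simp [List.replicate_succ])
    apply hx
    rcases hp with hp | hp
    · refine Or.inr ?_
      simpa [List.replicate_succ] using hp
    · have := le_two_of_replicate_mem_factors (u := []) (k := k + 3) (a := a + 1) (v := w)
        (by simpa [List.replicate_succ] using hp)
      omega

theorem oddCycle_injOn (m : ℕ) : Set.InjOn oddCycle (terminalRepresentatives m) := by
  rintro ⟨y, a⟩ hp ⟨y', a'⟩ hq h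
  rw [oddCycle, oddCycle, Cycle.coe_eq_coe, isRotated_iff_append] at h
  obtain ⟨u, v, h₁, h₂⟩ := h
  dsimp only at h₁ h₂
  by_cases hu : Even u.length
  · obtain ⟨k, w, rfl, rfl, rfl⟩ := exists_replicate_of_append h₁ h₂ hu
    obtain rfl := eq_of_mem_terminalRepresentatives hp hq.1
    simp
  · have hv : Even v.length := by
      have := congrArg List.length h₁
      simp only [List.length_append, length_thueMorseMap, List.length_singleton] at this
      rw [Nat.not_even_iff_odd] at hu
      obtain ⟨r, hr⟩ := hu
      exact ⟨y.length - r, by omega⟩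
    obtain ⟨k, w, rfl, rfl, rfl⟩ := exists_replicate_of_append h₂ h₁ hv
    obtain rfl := eq_of_mem_terminalRepresentatives hq hp.1
    simp

/-- The pairs `(x, a)` such that `(a + 1) x a` is a factor of length `m + 2`. -/
def distinctEnds (m : ℕ) : Set (List (ZMod 2) × ZMod 2) :=
  {p | (p.2 + 1) :: (p.1 ++ [p.2]) ∈ factors thueMorse (m + 2)}

theorem ncard_distinctEnds (m : ℕ) : (distinctEnds m).ncard = endsCount (m + 1) 1 := by
  have hinj : Function.Injective
      fun p : List (ZMod 2) × ZMod 2 => (p.2 + 1) :: (p.1 ++ [p.2]) := by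
    intro p q h
    exact append_pair_injective (List.cons.inj h).2
  rw [← Set.ncard_image_of_injective _ hinj, endsCount]
  congr 1
  ext w
  constructor
  · rintro ⟨⟨x, a⟩, ⟨i, hi⟩, rfl⟩
    refine ⟨i, ?_, hi.symm⟩
    dsimp only at hi
    rw [← cons_append_factorAt, List.cons.injEq, append_singleton_inj] at hi
    rw [Set.mem_ofPred_eq, ← hi.1, show i + (m + 1) = i + 1 + m by ring, ← hi.2.2,
      zmod_two_add_eq_one_iff]
  · rintro ⟨i, hi, rfl⟩
    have : factorAt thueMorse i (m + 1 + 1) = (thueMorse (i + 1 + m) + 1) ::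
        (factorAt thueMorse (i + 1) m ++ [thueMorse (i + 1 + m)]) := by
      rw [show i + 1 + m = i + (m + 1) by ring, ← zmod_two_add_eq_one_iff.mp hi,
        show i + (m + 1) = i + 1 + m by ring, cons_append_factorAt]
    exact ⟨(_, _), ⟨i, this.symm⟩, this.symm⟩

theorem ncard_append_mem_factors (m : ℕ) :
    {p : List (ZMod 2) × ZMod 2 | p.1 ++ [p.2] ∈ factors thueMorse (m + 1)}.ncard =
      (factors thueMorse (m + 1)).ncard := by
  rw [← Set.ncard_image_of_injective _ append_pair_injective]
  congr 1
  ext w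
  constructor
  · rintro ⟨p, hp, rfl⟩
    exact hp
  · rintro ⟨i, rfl⟩
    exact ⟨(factorAt thueMorse i m, thueMorse (i + m)), ⟨i, (factorAt_succ_right _ _ _).symm⟩,
      (factorAt_succ_right _ _ _).symm⟩

theorem ncard_cons_mem_factors (m : ℕ) :
    {p : List (ZMod 2) × ZMod 2 | (p.2 + 1) :: p.1 ∈ factors thueMorse (m + 1)}.ncard =
      (factors thueMorse (m + 1)).ncard := by
  have hinj : Function.Injective fun p : List (ZMod 2) × ZMod 2 => (p.2 + 1) :: p.1 := by
    rintro ⟨x, a⟩ ⟨y, b⟩ h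
    simp only [List.cons.injEq, add_left_inj] at h
    rw [h.1, h.2]
  rw [← Set.ncard_image_of_injective _ hinj]
  congr 1
  ext w
  constructor
  · rintro ⟨p, hp, rfl⟩
    exact hp
  · rintro ⟨i, rfl⟩
    have : (thueMorse i + 1 + 1) :: factorAt thueMorse (i + 1) m =
        factorAt thueMorse i (m + 1) := by
      rw [zmod_two_add_one_add_one, ← factorAt_succ]
    exact ⟨(factorAt thueMorse (i + 1) m, thueMorse i + 1), ⟨i, this⟩, this⟩

/-- Inclusion–exclusion: each condition alone is met by as many pairs as there are factors of length
m + 1. Pairs meeting both either extend to a factor (a+1)xa or are forbidden extensions. -/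
theorem ncard_oddRepresentatives (m : ℕ) :
    (oddRepresentatives m).ncard + (endsCount (m + 1) 1 + (forbiddenExtensions 1 m).ncard) =
      2 * (endsCount m 0 + endsCount m 1) := by
  set A := {p : List (ZMod 2) × ZMod 2 | p.1 ++ [p.2] ∈ factors thueMorse (m + 1)}
  set B := {p : List (ZMod 2) × ZMod 2 | (p.2 + 1) :: p.1 ∈ factors thueMorse (m + 1)}
  have hY : oddRepresentatives m = A ∪ B := rfl
  have hfin := finite_oddRepresentatives m
  rw [hY] at hfin
  have hA : A.Finite := hfin.subset Set.subset_union_left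
  have hB : B.Finite := hfin.subset Set.subset_union_right
  have hinter : A ∩ B = distinctEnds m ∪ forbiddenExtensions 1 m := by
    ext ⟨x, a⟩
    by_cases h : (a + 1) :: (x ++ [a]) ∈ factors thueMorse (m + 2)
    · refine ⟨fun _ => Or.inl h, fun _ => ⟨?_, ?_⟩⟩
      · obtain ⟨i, -, hi⟩ := cons_mem_factors_iff.mp h
        exact ⟨_, hi⟩
      · rw [← List.cons_append] at h
        obtain ⟨i, hi, -⟩ := append_mem_factors_iff.mp h
        exact ⟨_, hi⟩
    · exact ⟨fun h' => Or.inr ⟨h'.2, h'.1, h⟩, fun h' => h'.elim (fun h' => (h h').elim)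
        fun h' => ⟨h'.2.1, h'.1⟩⟩
  have hdisj : Disjoint (distinctEnds m) (forbiddenExtensions 1 m) := by
    rw [Set.disjoint_left]
    exact fun p hp hp' => hp'.2.2 hp
  have hD : (distinctEnds m).Finite := (hA.inter_of_left B).subset
    (hinter ▸ Set.subset_union_left)
  have := Set.ncard_union_add_ncard_inter A B hA hB
  rw [hinter, Set.ncard_union_eq hdisj hD (finite_forbiddenExtensions 1 m), ncard_distinctEnds,
    ncard_append_mem_factors, ncard_cons_mem_factors, ncard_factors] at this
  rw [hY, this]
  ring

/-- A square straddles a block boundary, so both occurrences of x have known alignment. For even l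
they agree, and x determines the letter after it. For odd l they disagree, which synchronization
excludes for l ≥ 5 and a finite check for l = 3. -/
theorem cons_append_mem_factors_of_squares {l : ℕ} (hl : 3 ≤ l) {x : List (ZMod 2)} {a : ZMod 2}
    (h₁ : (a + 1) :: (a + 1) :: x ∈ factors thueMorse (l + 2))
    (h₂ : x ++ [a] ++ [a] ∈ factors thueMorse (l + 2)) :
    (a + 1) :: (x ++ [a]) ∈ factors thueMorse (l + 2) := by
  obtain ⟨i, hi, h⟩ := cons_mem_factors_iff.mp h₁
  rw [factorAt_succ, List.cons.injEq] at h
  obtain ⟨hi', rfl⟩ := h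
  obtain ⟨j, h, hj'⟩ := append_mem_factors_iff.mp h₂
  rw [factorAt_succ_right, append_singleton_inj] at h
  obtain ⟨h, hj⟩ := h
  have hag := factorAt_eq_iff.mp h
  obtain ⟨r, rfl | rfl⟩ := Nat.even_or_odd' i
  · rw [thueMorse_two_mul_add_one] at hi'
    rw [thueMorse_two_mul] at hi
    rw [← hi] at hi'
    exact (zmod_two_add_one_ne _ hi'.symm).elim
  obtain ⟨s, hs | hs⟩ := Nat.even_or_odd' (j + l)
  · rw [show j + (l + 1) = 2 * s + 1 by omega, thueMorse_two_mul_add_one] at hj'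
    rw [hs, thueMorse_two_mul] at hj
    rw [← hj] at hj'
    exact (zmod_two_add_one_ne _ hj').elim
  obtain ⟨q, rfl | rfl⟩ := Nat.even_or_odd' l
  · refine ⟨2 * r + 1 + 1, ?_⟩
    rw [← cons_append_factorAt, ← hi', hj]
    congr 3
    have := hag (2 * q - 1) (by omega)
    rw [show 2 * r + 1 + 1 + 1 + (2 * q - 1) = 2 * (r + 1 + q) by omega,
      show j + (2 * q - 1) = 2 * s by omega, thueMorse_two_mul, thueMorse_two_mul] at this
    rw [show 2 * r + 1 + 1 + 1 + 2 * q = 2 * (r + 1 + q) + 1 by omega, hs,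
      thueMorse_two_mul_add_one, thueMorse_two_mul_add_one, this]
  · exfalso
    obtain ⟨p, rfl⟩ : ∃ p, j = 2 * p := ⟨s - q, by omega⟩
    obtain rfl | hq : q = 1 ∨ 2 ≤ q := by omega
    · have e0 : thueMorse (2 * (r + 1) + 1) = thueMorse (2 * p) := hag 0 (by omega)
      have e1 : thueMorse (2 * (r + 2)) = thueMorse (2 * p + 1) := hag 1 (by omega)
      have e2 : thueMorse (2 * (r + 2) + 1) = thueMorse (2 * (p + 1)) := hag 2 (by omega)
      have e3 : a = thueMorse (2 * (p + 1) + 1) := hj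
      have e4 : thueMorse (2 * (r + 1)) = a + 1 := hi'.symm
      simp only [thueMorse_two_mul_add_one, thueMorse_two_mul] at e0 e1 e2 e3 e4
      generalize thueMorse (r + 1) = b, thueMorse (r + 2) = c, thueMorse p = d,
        thueMorse (p + 1) = e at e0 e1 e2 e3 e4
      clear * - e0 e1 e2 e3 e4
      revert a b c d e; decide
    · exact factorAt_even_ne_odd (i := p) (j := r + 1) (n := 2 * q + 1) (by omega) h.symm

/-- A representative is non-terminal exactly when it is ((a+1)x, a) with (a+1)xa a factor of length
m + 1; these factors are counted by E_1(m). -/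
theorem ncard_oddRepresentatives_eq_add {m : ℕ} (hm : 4 ≤ m) :
    (oddRepresentatives m).ncard = (terminalRepresentatives m).ncard + endsCount m 1 := by
  obtain ⟨l, rfl⟩ := Nat.exists_eq_add_of_le' (show 1 ≤ m by omega)
  set g : List (ZMod 2) × ZMod 2 → List (ZMod 2) × ZMod 2 := fun p => ((p.2 + 1) :: p.1, p.2)
  have hg : Function.Injective g := by
    rintro ⟨x, a⟩ ⟨y, b⟩ h
    simp only [g, Prod.mk.injEq, List.cons.injEq] at h
    rw [h.1.2, h.2]
  have hstep : ∀ x a, (((a + 1) :: x, a) ∈ oddRepresentatives (l + 1) ∧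
      (x ++ [a], a) ∈ oddRepresentatives (l + 1)) ↔ (x, a) ∈ distinctEnds l := by
    intro x a
    constructor
    · rintro ⟨h₁ | h₁, h₂ | h₂⟩
      · exact h₁
      · exact h₂
      · exact cons_append_mem_factors_of_squares (by omega) h₁ h₂
      · exact h₂
    · exact fun h => ⟨Or.inl h, Or.inr h⟩
  have hunion : oddRepresentatives (l + 1) =
      terminalRepresentatives (l + 1) ∪ g '' distinctEnds l := by
    ext ⟨y, a⟩
    constructor
    · intro hy
      by_cases ht : (y, a) ∈ terminalRepresentatives (l + 1)
      · exact Or.inl ht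
      · obtain ⟨x, rfl, hx⟩ : ∃ x, y = (a + 1) :: x ∧
            (x ++ [a], a) ∈ oddRepresentatives (l + 1) := by
          by_contra! hcon
          exact ht ⟨hy, hcon⟩
        exact Or.inr ⟨(x, a), (hstep x a).mp ⟨hy, hx⟩, rfl⟩
    · rintro (h | ⟨⟨x, b⟩, hx, h⟩)
      · exact h.1
      · rw [← h]
        exact ((hstep x b).mpr hx).1
  have hfin := finite_oddRepresentatives (l + 1)
  have hdisj : Disjoint (terminalRepresentatives (l + 1)) (g '' distinctEnds l) := by
    rw [Set.disjoint_left]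
    rintro _ hp ⟨⟨x, a⟩, hx, rfl⟩
    exact hp.2 x rfl ((hstep x a).mpr hx).2
  rw [← ncard_distinctEnds, ← Set.ncard_image_of_injective (distinctEnds l) hg]
  rw [hunion] at hfin
  rw [← Set.ncard_union_eq hdisj (hfin.subset Set.subset_union_left)
    (hfin.subset Set.subset_union_right), ← hunion]

theorem cyclicComplexity_two_mul_add_one {m : ℕ} (hm : 4 ≤ m) :
    cyclicComplexity thueMorse (2 * m + 1) + endsCount m 1 + endsCount (m + 1) 1 +
      (forbiddenExtensions 1 m).ncard = 2 * (endsCount m 0 + endsCount m 1) := by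
  have h₁ := ncard_oddRepresentatives m
  have h₂ := ncard_oddRepresentatives_eq_add hm
  rw [cyclicComplexity, image_factors_odd, ← image_terminalRepresentatives,
    Set.InjOn.ncard_image (oddCycle_injOn m)]
  omega

/-! ### Small lengths, the set J and the final induction. -/

theorem cyclicComplexity_pos (n : ℕ) : 0 < cyclicComplexity thueMorse n :=
  (Set.ncard_pos (finite_cyclic_factors thueMorse n)).mpr ⟨_, _, factorAt_mem_factors _ 0 n, rfl⟩

theorem card_le_cyclicComplexity (n N : ℕ) :
    ((Finset.range N).image fun i =>
      ((factorAt thueMorse i n : List (ZMod 2)) : Cycle (ZMod 2))).card ≤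
        cyclicComplexity thueMorse n := by
  rw [← Set.ncard_coe_finset]
  refine Set.ncard_le_ncard ?_ (finite_cyclic_factors thueMorse n)
  intro c hc
  obtain ⟨i, -, rfl⟩ := Finset.mem_image.mp hc
  exact ⟨_, factorAt_mem_factors _ i n, rfl⟩

theorem cyclicComplexity_four : 2 ≤ cyclicComplexity thueMorse 4 :=
  le_trans (by decide) (card_le_cyclicComplexity 4 4)

theorem cyclicComplexity_five : 3 ≤ cyclicComplexity thueMorse 5 :=
  le_trans (by decide) (card_le_cyclicComplexity 5 12)

set_option maxRecDepth 4000 in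
theorem cyclicComplexity_six : 5 ≤ cyclicComplexity thueMorse 6 :=
  le_trans (by decide) (card_le_cyclicComplexity 6 16)

set_option maxRecDepth 4000 in
theorem cyclicComplexity_seven : 6 ≤ cyclicComplexity thueMorse 7 :=
  le_trans (by decide) (card_le_cyclicComplexity 7 16)

theorem cyclicComplexity_odd {m : ℕ} (hm : 4 ≤ m) :
    4 * ((2 * m + 1 : ℕ) : ℤ) ≤ 3 * cyclicComplexity thueMorse (2 * m + 1) + 12 ∧
    (3 * (cyclicComplexity thueMorse (2 * m + 1) : ℤ) + 12 = 4 * ((2 * m + 1 : ℕ) : ℤ) ↔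
      ∃ j, 1 ≤ j ∧ m = 2 ^ (2 * j)) := by
  have hc := cyclicComplexity_two_mul_add_one hm
  have hd := endsCount_two_mul_add_one (m := m) (by omega) 1
  rw [show (1 + 1 : ZMod 2) = 0 from rfl] at hd
  have heq : 3 * (cyclicComplexity thueMorse (2 * m + 1) : ℤ) + 12 =
      4 * ((2 * m + 1 : ℕ) : ℤ) + diffExcess (2 * m + 1) + 12 - 3 * factorsIncrement m -
        3 * (forbiddenExtensions 1 m).ncard := by
    rw [diffExcess, factorsIncrement]
    push_cast
    omega
  have hpos := (excess_bounds (2 * m + 1) (by omega)).1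
  have hinc := factorsIncrement_eq m (by omega)
  rw [← odd_excess_eq_zero_iff m hm]
  obtain h | ⟨k, rfl, hk, hcard⟩ := forbiddenExtensions_eq_empty_or m (by omega) 1
  · rw [h, Set.ncard_empty] at heq
    omega
  · rcases k with _ | k
    · exact absurd hk (by decide)
    · have h₁ := diffExcess_six_mul_two_pow_add_one k
      have h₂ := (factorsIncrement_two_pow (k + 1)).2.2
      have h₃ : (1 : ℤ) ≤ 2 ^ k := one_le_pow₀ (by norm_num)
      omega

theorem two_mul_mem_setJ_iff {m : ℕ} : 2 * m ∈ setJ ↔ m ∈ setJ := by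
  constructor
  · rintro ⟨i, j, hi, h⟩
    rcases j with _ | j
    · rw [pow_succ'] at h
      omega
    · refine ⟨i, j, hi, ?_⟩
      have : 2 * m = 2 * ((2 ^ (2 * i + 1) + 1) * 2 ^ j) := by rw [h]; ring
      omega
  · rintro ⟨i, j, hi, rfl⟩
    exact ⟨i, j + 1, hi, by ring⟩

theorem two_mul_add_one_mem_setJ_iff {m : ℕ} :
    2 * m + 1 ∈ setJ ↔ ∃ j, 1 ≤ j ∧ m = 2 ^ (2 * j) := by
  constructor
  · rintro ⟨i, j, hi, h⟩
    rcases j with _ | j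
    · exact ⟨i, hi, by rw [pow_succ'] at h; omega⟩
    · have : 2 * m + 1 = 2 * ((2 ^ (2 * i + 1) + 1) * 2 ^ j) := by rw [h]; ring
      omega
  · rintro ⟨j, hj, rfl⟩
    exact ⟨j, 0, hj, by ring⟩

theorem nine_le_of_mem_setJ {n : ℕ} (h : n ∈ setJ) : 9 ≤ n := by
  obtain ⟨i, j, hi, rfl⟩ := h
  have h₁ : 2 ^ 3 ≤ 2 ^ (2 * i + 1) := Nat.pow_le_pow_right (by norm_num) (by omega)
  have h₂ : 1 ≤ 2 ^ j := Nat.one_le_two_pow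
  nlinarith

theorem diffExcess_eq_zero_of_mem_setJ {n : ℕ} (h : n ∈ setJ) : diffExcess n = 0 := by
  obtain ⟨i, j, hi, rfl⟩ := h
  induction j with
  | zero => rw [pow_zero, mul_one, (diffExcess_two_pow_add_one i).1]
  | succ j ih =>
    have h₁ : 1 ≤ 2 ^ (2 * i + 1) := Nat.one_le_two_pow
    have h₂ : 1 ≤ 2 ^ j := Nat.one_le_two_pow
    rw [show (2 ^ (2 * i + 1) + 1) * 2 ^ (j + 1) = 2 * ((2 ^ (2 * i + 1) + 1) * 2 ^ j) by ring,
      diffExcess_two_mul (by nlinarith), ih, mul_zero]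

theorem cyclicComplexity_excess (n : ℕ) :
    4 * (n : ℤ) ≤ 3 * cyclicComplexity thueMorse n + 12 ∧
    (3 * (cyclicComplexity thueMorse n : ℤ) + 12 = 4 * n ↔ n ∈ setJ) := by
  induction n using Nat.strong_induction_on with
  | _ n ih =>
  obtain hn | hn : n < 8 ∨ 8 ≤ n := by omega
  · have hJ : n ∉ setJ := fun h => by
      have := nine_le_of_mem_setJ h
      omega
    have h₃ := cyclicComplexity_pos 3
    have h₄ := cyclicComplexity_four
    have h₅ := cyclicComplexity_five
    have h₆ := cyclicComplexity_six
    have h₇ := cyclicComplexity_seven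
    simp only [hJ, iff_false]
    -- The lower bounds 1, 2, 3, 5, 6 for n = 3, …, 7 are the least integers c with 3c + 12 > 4n.
    interval_cases n <;> omega
  · obtain ⟨m, rfl | rfl⟩ := Nat.even_or_odd' n
    · obtain ⟨h₁, h₂⟩ := ih m (by omega)
      have hd := (excess_bounds m (by omega)).1
      have hJ : m ∈ setJ → diffExcess m = 0 := diffExcess_eq_zero_of_mem_setJ
      rw [cyclicComplexity_two_mul (by omega), two_mul_mem_setJ_iff, ← h₂]
      rw [← h₂] at hJ
      rw [diffExcess] at hd hJ
      push_cast
      constructor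
      · omega
      · constructor
        · intro h
          omega
        · intro h
          have := hJ h
          omega
    · rw [two_mul_add_one_mem_setJ_iff]
      exact cyclicComplexity_odd (by omega)

theorem theorem8 (n : ℕ) :
    (cyclicComplexity thueMorse n : ℝ) = 4 / 3 * (n : ℝ) - 4 ↔ n ∈ setJ := by
  rw [← (cyclicComplexity_excess n).2]
  have hcast : (3 * (cyclicComplexity thueMorse n : ℤ) + 12 = 4 * n) ↔
      3 * (cyclicComplexity thueMorse n : ℝ) + 12 = 4 * n := by exact_mod_cast Iff.rfl
  rw [hcast]
  constructor <;> intro h <;> linarith
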